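/- **Setting.** Let $\Theta$ be a topological space with its Borel $\sigma$-algebra and a $\sigma$-finite reference measure $\Omega$. Let $p$ be a (measurable) probability density on $\Theta$ with respect to $\Omega$ (the prior of $\theta$), and $q(\theta,\theta')$ a jointly measurable proposal density, $\int q(\theta,\theta')\,d\Omega(\theta')=1$. Let $A$ be a finite set of nodes, each with a measurable likelihood factor $f_a:\Theta\to(0,\infty)$, and let $A$ be partitioned into one global section $A_0$ and $N\ge 1$ local sections $A_1,\dots,A_N$ (sections may be empty). The target distribution $\pi$ has density proportional to $p(\theta)\prod_{a\in A}f_a(\theta)$. Put $w_v=\frac{p(\theta')\,q(\theta',\theta)}{p(\theta)\,q(\theta,\theta')}$ and $w_a=f_a(\theta')/f_a(\theta)$. *Exact chain.* From $\theta$, propose $\theta'\sim q(\theta,\cdot)$ and accept it with probability $P_a(\theta,\theta')=\min\{1,w_v\prod_{a\in A}w_a\}$ (read as $1$ if $p(\theta)q(\theta,\theta')=0$); otherwise stay at $\theta$. Its kernel is $\mathcal T$. *Approximate chain.* Fix a mini-batch size $m\ge 1$ and a tolerance $\varepsilon>0$. Accept $\theta'$ by the following test instead. Draw $u\sim\mathrm{Uniform}[0,1]$,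 put $\mu_0=\frac1N\big(\log u-\log w_v-\sum_{a\in A_0}\log w_a\big)$ and $l_i=\sum_{a\in A_i}\log w_a$. Draw mini-batches of $m$ of the $l_i$, uniformly without replacement (the last one takes what is left). After each batch, let $n$ be the number of values drawn so far, $\hat\mu$ and $s_l$ their mean and sample standard deviation, and $s=\frac{s_l}{\sqrt n}\sqrt{1-\frac{n-1}{N-1}}$; stop if $n=N$, or if $s_l\ne0$ and $P\big(t_{n-1}>|\hat\mu-\mu_0|/s\big)<\varepsilon$, where $t_{n-1}$ is Student distributed with $n-1$ degrees of freedom. On stopping, accept if and only if $\hat\mu>\mu_0$. (If $w_v=+\infty$ or $w_v=0$, i.e. $\mu_0=\mp\infty$, always accept, respectively always reject.) The kernel is $\mathcal T_\varepsilon$. **Corollary.** Assume that either (1) $\Theta$ is compact and all $f_a$ are continuous, or (2) $\Theta$ is finite. Assume that the exact chain satisfies Doeblin's condition: there are $n_0\ge1$, $c>0$ and a probability measure $\nu$ with $\mathcal T^{n_0}(\theta,\cdot)\ge c\,\nu$ for all $\theta\in\Theta$. Then: * There is $\varepsilon_0>0$ such that for every $0<\varepsilon<\varepsilon_0$ the approximate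 chain is uniformly ergodic: it has a unique stationary distribution $\pi_\varepsilon$, and there are $C<\infty$, $\rho\in[0,1)$ with $\|\mathcal T_\varepsilon^n(\theta,\cdot)-\pi_\varepsilon\|_{\mathrm{TV}}\le C\rho^n$ for all $n\ge 0$ and $\theta\in\Theta$. * $\|\pi_\varepsilon-\pi\|_{\mathrm{TV}}\to0$ as $\varepsilon\downarrow0$. * $\|\mathcal T_\varepsilon(\theta,\cdot)-\mathcal T(\theta,\cdot)\|_{\mathrm{TV}}\to0$ as $\varepsilon\downarrow0$ for every $\theta\in\Theta$; and if $\Theta$ is finite, there is a function $\delta$ with $\delta(\varepsilon)\to0$ as $\varepsilon\downarrow0$ and $\|\mathcal T_\varepsilon(\theta,\cdot)-\mathcal T(\theta,\cdot)\|_{\mathrm{TV}}\le\delta(\varepsilon)$ for all $\theta\in\Theta$ and $\varepsilon>0$. -/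

import Mathlib

open MeasureTheory ProbabilityTheory Filter Topology
open scoped ENNReal

noncomputable section

namespace SubsampledMH

/-! ### The sequential test -/

/-- Density of Student's t distribution with `ν` degrees of freedom. -/
def studentPDF (ν : ℕ) (x : ℝ) : ℝ :=
  Real.Gamma (((ν : ℝ) + 1) / 2) / (Real.sqrt (ν * Real.pi) * Real.Gamma ((ν : ℝ) / 2)) *
    (1 + x ^ 2 / ν) ^ (-(((ν : ℝ) + 1) / 2))

/-- Student's t distribution with `ν` degrees of freedom. -/
def studentT (ν : ℕ) : Measure ℝ :=
  volume.withDensity fun x => ENNReal.ofReal (studentPDF ν x)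

/-- The p-value `P(T > |x|)`, where `T` is Student distributed with `ν` degrees of freedom. -/
def pValue (ν : ℕ) (x : ℝ) : ℝ := (studentT ν).real (Set.Ioi |x|)

/-- Mean of the first `n` elements of the population `l`, listed in the order `σ`. -/
def sampleMean {N : ℕ} (l : Fin N → ℝ) (σ : Equiv.Perm (Fin N)) (n : ℕ) : ℝ :=
  (∑ i : Fin N with i.val < n, l (σ i)) / n

/-- Sample standard deviation (with denominator `n - 1`) of the first `n` elements of the
population `l`, listed in the order `σ`. For `n = 1` it is `0`. -/
def sampleStd {N : ℕ} (l : Fin N → ℝ) (σ : Equiv.Perm (Fin N)) (n : ℕ) : ℝ :=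
  Real.sqrt ((∑ i : Fin N with i.val < n, (l (σ i) - sampleMean l σ n) ^ 2) / ((n : ℝ) - 1))

/-- Estimated standard deviation of the sample mean, with the finite population correction. -/
def stdOfMean {N : ℕ} (l : Fin N → ℝ) (σ : Equiv.Perm (Fin N)) (n : ℕ) : ℝ :=
  sampleStd l σ n / Real.sqrt n * Real.sqrt (1 - ((n : ℝ) - 1) / ((N : ℝ) - 1))

/-- Number of elements observed after `t` mini-batches of size `m` (the last mini-batch takes
what is left of the population). -/
def numObserved (N m t : ℕ) : ℕ := min (t * m) N

/-- The test stops after the `t`-th mini-batch: either everything has been observed, or the sample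
standard deviation is nonzero and the p-value of the t statistic is lower than `ε`. -/
def Stops {N : ℕ} (m : ℕ) (ε μ₀ : ℝ) (l : Fin N → ℝ) (σ : Equiv.Perm (Fin N)) (t : ℕ) : Prop :=
  numObserved N m t = N ∨
    (sampleStd l σ (numObserved N m t) ≠ 0 ∧
      pValue (numObserved N m t - 1)
        ((sampleMean l σ (numObserved N m t) - μ₀) / stdOfMean l σ (numObserved N m t)) < ε)

/-- The test, drawing the population in the order `σ`, accepts `μ > μ₀`: at the first mini-batch
after which it stops, the sample mean exceeds `μ₀`. -/
def TestAccepts {N : ℕ} (m : ℕ) (ε μ₀ : ℝ) (l : Fin N → ℝ) (σ : Equiv.Perm (Fin N)) : Prop :=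
  ∃ t : ℕ, 1 ≤ t ∧ Stops m ε μ₀ l σ t ∧ (∀ r : ℕ, 1 ≤ r → r < t → ¬ Stops m ε μ₀ l σ r) ∧
    μ₀ < sampleMean l σ (numObserved N m t)

open Classical in
/-- Probability that the test accepts. Successive mini-batches drawn uniformly without replacement
are the consecutive blocks of a uniformly random ordering of the population. -/
def testAcceptProb {N : ℕ} (m : ℕ) (ε μ₀ : ℝ) (l : Fin N → ℝ) : ℝ :=
  (∑ σ : Equiv.Perm (Fin N), if TestAccepts m ε μ₀ l σ then (1 : ℝ) else 0) / (N.factorial : ℝ)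

/-! ### Measurability of the test -/

theorem measurable_pValue (ν : ℕ) : Measurable (pValue ν) := by
  have h : Antitone fun x : ℝ => studentT ν (Set.Ioi x) :=
    fun a b hab => measure_mono (Set.Ioi_subset_Ioi hab)
  exact (h.measurable.comp (measurable_norm : Measurable fun x : ℝ => ‖x‖)).ennreal_toReal

theorem measurable_sampleMean {N : ℕ} (σ : Equiv.Perm (Fin N)) (n : ℕ) :
    Measurable fun l : Fin N → ℝ => sampleMean l σ n := by
  unfold sampleMean
  fun_prop

theorem measurable_sampleStd {N : ℕ} (σ : Equiv.Perm (Fin N)) (n : ℕ) :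
    Measurable fun l : Fin N → ℝ => sampleStd l σ n := by
  have := measurable_sampleMean σ n
  unfold sampleStd
  fun_prop

theorem measurable_stdOfMean {N : ℕ} (σ : Equiv.Perm (Fin N)) (n : ℕ) :
    Measurable fun l : Fin N → ℝ => stdOfMean l σ n := by
  have := measurable_sampleStd σ n
  unfold stdOfMean
  fun_prop

theorem measurableSet_stops {N : ℕ} (m : ℕ) (ε : ℝ) (σ : Equiv.Perm (Fin N)) (t : ℕ) :
    MeasurableSet {p : ℝ × (Fin N → ℝ) | Stops m ε p.1 p.2 σ t} := by
  have h1 := (measurable_sampleMean σ (numObserved N m t)).comp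
    (measurable_snd : Measurable (Prod.snd : ℝ × (Fin N → ℝ) → _))
  have h2 := (measurable_sampleStd σ (numObserved N m t)).comp
    (measurable_snd : Measurable (Prod.snd : ℝ × (Fin N → ℝ) → _))
  have h3 := (measurable_stdOfMean σ (numObserved N m t)).comp
    (measurable_snd : Measurable (Prod.snd : ℝ × (Fin N → ℝ) → _))
  have h4 := (measurable_pValue (numObserved N m t - 1)).comp ((h1.sub measurable_fst).div h3)
  refine (MeasurableSet.const _).union (MeasurableSet.inter ?_ ?_)
  · exact (measurableSet_eq_fun h2 measurable_const).compl
  · exact measurableSet_lt h4 measurable_const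

theorem measurableSet_testAccepts {N : ℕ} (m : ℕ) (ε : ℝ) (σ : Equiv.Perm (Fin N)) :
    MeasurableSet {p : ℝ × (Fin N → ℝ) | TestAccepts m ε p.1 p.2 σ} := by
  have h1 (t : ℕ) := (measurable_sampleMean σ (numObserved N m t)).comp
    (measurable_snd : Measurable (Prod.snd : ℝ × (Fin N → ℝ) → _))
  simp only [TestAccepts, Set.ofPred_exists, Set.ofPred_and, Set.ofPred_forall]
  refine MeasurableSet.iUnion fun t => (MeasurableSet.const _).inter
    ((measurableSet_stops m ε σ t).inter (MeasurableSet.inter ?_ ?_))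
  · exact MeasurableSet.iInter fun r => MeasurableSet.iInter fun _ => MeasurableSet.iInter fun _ =>
      (measurableSet_stops m ε σ r).compl
  · exact measurableSet_lt measurable_fst (h1 t)

theorem measurable_testAcceptProb {X : Type*} [MeasurableSpace X] {N : ℕ} (m : ℕ) (ε : ℝ)
    {f : X → ℝ} {g : X → Fin N → ℝ} (hf : Measurable f) (hg : Measurable g) :
    Measurable fun x => testAcceptProb m ε (f x) (g x) := by
  classical
  unfold testAcceptProb
  refine (Finset.measurable_sum _ fun σ _ => ?_).div_const _
  exact Measurable.ite ((hf.prodMk hg) (measurableSet_testAccepts m ε σ))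
    measurable_const measurable_const

/-! ### Models with a partitioned scaffold -/

/-- The data of a Metropolis-Hastings update of a variable `θ`, whose scaffold consists of `θ`, of
nodes determined by `θ`, and of a finite set `ι` of absorbing nodes, partitioned into one global
section and `N` local sections. Densities on `Θ` are with respect to `base`. -/
structure Model (Θ ι : Type*) [MeasurableSpace Θ] (N : ℕ) where
  /-- reference measure -/
  base : Measure Θ
  sigmaFinite_base : SigmaFinite base
  /-- density of `θ` given its parents -/
  prior : Θ → ℝ
  prior_nonneg : ∀ θ, 0 ≤ prior θ
  measurable_prior : Measurable prior
  lintegral_prior : ∫⁻ θ, ENNReal.ofReal (prior θ) ∂base = 1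
  /-- `lik a θ` is the probability (density) of the fixed value of the absorbing node `a` given its
  parents, as a function of `θ` -/
  lik : ι → Θ → ℝ
  lik_pos : ∀ a θ, 0 < lik a θ
  measurable_lik : ∀ a, Measurable (lik a)
  /-- the section of a node: `none` is the global section, `some i` the `i`-th local section -/
  sec : ι → Option (Fin N)
  /-- `prop θ θ'` is the density at `θ'` of the proposal made from `θ` -/
  prop : Θ → Θ → ℝ
  prop_nonneg : ∀ θ θ', 0 ≤ prop θ θ'
  measurable_prop : Measurable (Function.uncurry prop)
  lintegral_prop : ∀ θ, ∫⁻ θ', ENNReal.ofReal (prop θ θ') ∂base = 1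

namespace Model

variable {Θ ι : Type*} [MeasurableSpace Θ] {N : ℕ} (M : Model Θ ι N)

/-- The unnormalised target density: prior times the likelihood of all absorbing nodes. -/
def unnormDensity [Fintype ι] (θ : Θ) : ℝ := M.prior θ * ∏ a, M.lik a θ

/-- The target distribution, that is, the conditional distribution of `θ` given the rest. -/
def target [Fintype ι] : Measure Θ :=
  (∫⁻ θ, ENNReal.ofReal (M.unnormDensity θ) ∂M.base)⁻¹ •
    M.base.withDensity fun θ => ENNReal.ofReal (M.unnormDensity θ)

/-- The weight of the updated variable itself. -/
def wVar (θ θ' : Θ) : ℝ := M.prior θ' / M.prop θ θ' * (M.prop θ' θ / M.prior θ)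

/-- The weight of the absorbing node `a`. -/
def wNode (a : ι) (θ θ' : Θ) : ℝ := M.lik a θ' / M.lik a θ

/-- The acceptance probability of exact Metropolis-Hastings. As usual it is `1` where the
denominator of the ratio vanishes. -/
def acceptProb [Fintype ι] (θ θ' : Θ) : ℝ :=
  if M.prior θ * M.prop θ θ' = 0 then 1 else min 1 (M.wVar θ θ' * ∏ a, M.wNode a θ θ')

/-- The threshold `μ₀`, given the uniform random number `u`. -/
def threshold [Fintype ι] (θ θ' : Θ) (u : ℝ) : ℝ :=
  (Real.log u - (Real.log (M.wVar θ θ') +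
    ∑ a with M.sec a = none, Real.log (M.wNode a θ θ'))) / N

/-- The log-weight `l_i` of the `i`-th local section. -/
def localLog [Fintype ι] (θ θ' : Θ) (i : Fin N) : ℝ :=
  ∑ a with M.sec a = some i, Real.log (M.wNode a θ θ')

/-- The acceptance probability when the decision is made by the sequential test with mini-batches
of size `m` and tolerance `ε`. Where the weight `wVar` is infinite or zero, `μ₀` is `-∞` or `+∞`,
and the test always accepts or always rejects, respectively. -/
def approxAcceptProb [Fintype ι] (m : ℕ) (ε : ℝ) (θ θ' : Θ) : ℝ :=
  if M.prior θ * M.prop θ θ' = 0 then 1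
  else if M.prior θ' * M.prop θ' θ = 0 then 0
  else ∫ u in Set.Ioc (0 : ℝ) 1, testAcceptProb m ε (M.threshold θ θ' u) (M.localLog θ θ')

theorem measurable_wVar : Measurable (Function.uncurry M.wVar) := by
  have h1 := M.measurable_prior
  have h2 := M.measurable_prop
  have h3 : Measurable fun p : Θ × Θ => M.prop p.2 p.1 := h2.comp measurable_swap
  have h4 : Measurable fun p : Θ × Θ => M.prop p.1 p.2 := h2
  unfold Model.wVar Function.uncurry
  fun_prop

theorem measurable_wNode (a : ι) : Measurable (Function.uncurry (M.wNode a)) := by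
  have h1 := M.measurable_lik a
  unfold Model.wNode Function.uncurry
  fun_prop

theorem measurable_num_denom :
    Measurable (fun p : Θ × Θ => M.prior p.1 * M.prop p.1 p.2) ∧
      Measurable (fun p : Θ × Θ => M.prior p.2 * M.prop p.2 p.1) := by
  have h1 := M.measurable_prior
  have h2 := M.measurable_prop
  have h3 : Measurable fun p : Θ × Θ => M.prop p.2 p.1 := h2.comp measurable_swap
  have h4 : Measurable fun p : Θ × Θ => M.prop p.1 p.2 := h2
  constructor <;> fun_prop

theorem measurable_acceptProb [Fintype ι] : Measurable (Function.uncurry M.acceptProb) := by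
  have h1 := M.measurable_wVar
  have h2 := M.measurable_wNode
  refine Measurable.ite (measurableSet_eq_fun M.measurable_num_denom.1 measurable_const)
    measurable_const (measurable_const.min (h1.mul ?_))
  exact Finset.measurable_prod _ fun a _ => h2 a

theorem measurable_localLog [Fintype ι] :
    Measurable fun p : Θ × Θ => M.localLog p.1 p.2 :=
  measurable_pi_lambda _ fun _ =>
    Finset.measurable_sum _ fun a _ => Real.measurable_log.comp (M.measurable_wNode a)

theorem measurable_threshold [Fintype ι] :
    Measurable fun x : (Θ × Θ) × ℝ => M.threshold x.1.1 x.1.2 x.2 := by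
  have hw : Measurable fun p : Θ × Θ => Real.log (M.wVar p.1 p.2) :=
    Real.measurable_log.comp M.measurable_wVar
  have hg : Measurable fun p : Θ × Θ =>
      ∑ a with M.sec a = none, Real.log (M.wNode a p.1 p.2) :=
    Finset.measurable_sum _ fun a _ => Real.measurable_log.comp (M.measurable_wNode a)
  unfold Model.threshold
  exact ((Real.measurable_log.comp measurable_snd).sub
    ((hw.comp measurable_fst).add (hg.comp measurable_fst))).div_const _

theorem measurable_integral_test [Fintype ι] (m : ℕ) (ε : ℝ) :
    Measurable fun p : Θ × Θ => ∫ u in Set.Ioc (0 : ℝ) 1,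
      testAcceptProb m ε (M.threshold p.1 p.2 u) (M.localLog p.1 p.2) := by
  have hF : Measurable fun x : (Θ × Θ) × ℝ =>
      testAcceptProb m ε (M.threshold x.1.1 x.1.2 x.2) (M.localLog x.1.1 x.1.2) :=
    measurable_testAcceptProb m ε M.measurable_threshold
      (M.measurable_localLog.comp measurable_fst)
  exact (StronglyMeasurable.integral_prod_right' (ν := volume.restrict (Set.Ioc (0 : ℝ) 1))
    hF.stronglyMeasurable).measurable

theorem measurable_approxAcceptProb [Fintype ι] (m : ℕ) (ε : ℝ) :
    Measurable (Function.uncurry (M.approxAcceptProb m ε)) := by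
  have h0 := measurableSet_eq_fun M.measurable_num_denom.1 (measurable_const (a := (0 : ℝ)))
  have h1 := measurableSet_eq_fun M.measurable_num_denom.2 (measurable_const (a := (0 : ℝ)))
  unfold Model.approxAcceptProb Function.uncurry
  exact Measurable.ite h0 measurable_const
    (Measurable.ite h1 measurable_const (M.measurable_integral_test m ε))

/-- The Metropolis type kernel that draws `θ'` from the proposal, moves to `θ'` with probability
`α θ θ'`, and stays at `θ` otherwise. -/
def mhKernel (α : Θ → Θ → ℝ) (hα : Measurable (Function.uncurry α)) : Kernel Θ Θ where
  toFun θ :=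
    M.base.withDensity (fun θ' => ENNReal.ofReal (α θ θ' * M.prop θ θ')) +
      (∫⁻ θ', ENNReal.ofReal ((1 - α θ θ') * M.prop θ θ') ∂M.base) • Measure.dirac θ
  measurable' := by
    have := M.sigmaFinite_base
    have h1 : Measurable fun p : Θ × Θ => ENNReal.ofReal (α p.1 p.2 * M.prop p.1 p.2) :=
      (hα.mul M.measurable_prop).ennreal_ofReal
    have h2 : Measurable fun p : Θ × Θ => ENNReal.ofReal ((1 - α p.1 p.2) * M.prop p.1 p.2) :=
      ((measurable_const.sub hα).mul M.measurable_prop).ennreal_ofReal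
    refine Measure.measurable_of_measurable_coe _ fun s hs => ?_
    simp only [Measure.coe_add, Pi.add_apply, Measure.coe_smul, Pi.smul_apply, smul_eq_mul,
      withDensity_apply _ hs, Measure.dirac_apply' _ hs]
    exact (h1.lintegral_prod_right' (ν := M.base.restrict s)).add
      ((h2.lintegral_prod_right' (ν := M.base)).mul (measurable_one.indicator hs))

/-- The transition kernel of exact Metropolis-Hastings. -/
def exactKernel [Fintype ι] : Kernel Θ Θ := M.mhKernel M.acceptProb M.measurable_acceptProb

/-- The transition kernel of approximate Metropolis-Hastings, with mini-batches of size `m` and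
tolerance `ε`. -/
def approxKernel [Fintype ι] (m : ℕ) (ε : ℝ) : Kernel Θ Θ :=
  M.mhKernel (M.approxAcceptProb m ε) (M.measurable_approxAcceptProb m ε)

end Model

/-! ### Ergodicity -/

/-- Total variation distance of two probability measures. -/
def tvDist {Θ : Type*} [MeasurableSpace Θ] (μ ν : Measure Θ) : ℝ :=
  ⨆ A : {A : Set Θ // MeasurableSet A}, |μ.real A.1 - ν.real A.1|

/-- `π` is a stationary distribution of `κ`, to which the chain converges in total variation
geometrically fast, uniformly in the starting point. -/
def UniformlyErgodic {Θ : Type*} [MeasurableSpace Θ] (κ : Kernel Θ Θ) (π : Measure Θ) : Prop :=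
  IsProbabilityMeasure π ∧ κ.Invariant π ∧
    ∃ C ρ : ℝ, 0 ≤ ρ ∧ ρ < 1 ∧ ∀ (n : ℕ) (θ : Θ), tvDist ((κ ^ n) θ) π ≤ C * ρ ^ n

/-- Doeblin's condition: for some number of steps, the transition probabilities from all points
have a common nonzero component. -/
def Doeblin {Θ : Type*} [MeasurableSpace Θ] (κ : Kernel Θ Θ) : Prop :=
  ∃ n : ℕ, 1 ≤ n ∧ ∃ c : ℝ≥0∞, 0 < c ∧ ∃ ν : Measure Θ, IsProbabilityMeasure ν ∧
    ∀ (θ : Θ) (A : Set Θ), MeasurableSet A → c * ν A ≤ (κ ^ n) θ A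

end SubsampledMH

end

/-! Two facts about the test carry the proof, and neither needs a quantitative error bound.

Domination, uniform in `ε`. Mini-batches are blocks of a uniformly random ordering. If the `l_i`
happen to come in decreasing order, every sample mean is at least the population mean, so the test
accepts whenever the exact decision is to accept, wherever it stops; increasing order does the same
for rejection. Each order has probability at least `1/N!`. Hence the acceptance and the rejection
probability are each at least `1/N!` times the exact one, and the approximate kernel dominates
`1/N!` times the exact kernel. Its `n`-th power dominates `(1/N!)^n` times that of the exact kernel,
so Doeblin's condition is inherited with a constant free of `ε` (`exists_approxKernel_minorised`).
Uniform ergodicity follows by contraction in total variation (`exists_uniformlyErgodic`).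

Pointwise convergence. Student tails are positive, so for fixed data and small `ε` the test never
stops early and decides exactly (`eventually_testAcceptProb_eq`). Dominated convergence, over `u`,
then over the proposal, then over the target, makes the one-step discrepancy averaged over the
target tend to 0 (`tendsto_integral_stepDiff`).

The two meet in the perturbation bound `tvDist_invariant_le`: the distance of the stationary laws is
at most `n/c` times the distance by which one approximate step moves the target. The target is
stationary for the exact chain, so this distance is bounded by that averaged discrepancy, and no
convergence uniform in `θ` is needed. -/

noncomputable section

namespace SubsampledMH

/-! ### Total variation distance -/

section TotalVariation

variable {Θ : Type*} [MeasurableSpace Θ]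

theorem tvDist_nonneg (μ ν : Measure Θ) : 0 ≤ tvDist μ ν :=
  Real.iSup_nonneg fun _ => abs_nonneg _

theorem abs_measureReal_sub_le_one (μ ν : Measure Θ) [IsProbabilityMeasure μ]
    [IsProbabilityMeasure ν] (A : Set Θ) : |μ.real A - ν.real A| ≤ 1 := by
  have h1 : μ.real A ≤ 1 := measureReal_le_one
  have h2 : ν.real A ≤ 1 := measureReal_le_one
  have h3 : 0 ≤ μ.real A := measureReal_nonneg
  have h4 : 0 ≤ ν.real A := measureReal_nonneg
  rw [abs_le]
  constructor <;> linarith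

theorem abs_sub_le_tvDist (μ ν : Measure Θ) [IsProbabilityMeasure μ] [IsProbabilityMeasure ν]
    {A : Set Θ} (hA : MeasurableSet A) : |μ.real A - ν.real A| ≤ tvDist μ ν :=
  le_ciSup (f := fun A : {A : Set Θ // MeasurableSet A} => |μ.real A.1 - ν.real A.1|)
    ⟨1, by rintro _ ⟨A, rfl⟩; exact abs_measureReal_sub_le_one μ ν A.1⟩ ⟨A, hA⟩

theorem tvDist_le {μ ν : Measure Θ} {b : ℝ}
    (h : ∀ A, MeasurableSet A → |μ.real A - ν.real A| ≤ b) : tvDist μ ν ≤ b :=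
  haveI : Nonempty {A : Set Θ // MeasurableSet A} := ⟨⟨∅, .empty⟩⟩
  ciSup_le fun A => h A.1 A.2

theorem tvDist_le_one (μ ν : Measure Θ) [IsProbabilityMeasure μ] [IsProbabilityMeasure ν] :
    tvDist μ ν ≤ 1 := tvDist_le fun A _ => abs_measureReal_sub_le_one μ ν A

theorem tvDist_self (μ : Measure Θ) : tvDist μ μ = 0 :=
  le_antisymm (tvDist_le fun _ _ => by simp) (tvDist_nonneg _ _)

theorem tvDist_triangle (μ ν ξ : Measure Θ) [IsProbabilityMeasure μ] [IsProbabilityMeasure ν]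
    [IsProbabilityMeasure ξ] : tvDist μ ξ ≤ tvDist μ ν + tvDist ν ξ :=
  tvDist_le fun _ hA => (abs_sub_le _ _ _).trans
    (add_le_add (abs_sub_le_tvDist μ ν hA) (abs_sub_le_tvDist ν ξ hA))

theorem eq_of_tvDist_le_zero {μ ν : Measure Θ} [IsProbabilityMeasure μ] [IsProbabilityMeasure ν]
    (h : tvDist μ ν ≤ 0) : μ = ν := by
  ext A hA
  have h1 : |μ.real A - ν.real A| ≤ 0 := (abs_sub_le_tvDist μ ν hA).trans h
  have h2 : μ.real A = ν.real A := by
    have := abs_nonpos_iff.1 h1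
    linarith
  exact (measureReal_eq_measureReal_iff).1 h2

/-- Layer cake: both integrals are integrals over levels `t` in `(0, b]` of superlevel-set measures,
which differ by at most the total variation distance. The sharp constant `b` is what later yields a
contraction factor below 1. -/
theorem abs_integral_sub_le_tvDist (μ ν : Measure Θ) [IsProbabilityMeasure μ]
    [IsProbabilityMeasure ν] {f : Θ → ℝ} (hf : Measurable f) {b : ℝ} (hb : 0 ≤ b)
    (h0 : ∀ θ, 0 ≤ f θ) (h1 : ∀ θ, f θ ≤ b) :
    |∫ θ, f θ ∂μ - ∫ θ, f θ ∂ν| ≤ b * tvDist μ ν := by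
  have layer (ξ : Measure Θ) [IsProbabilityMeasure ξ] :
      ∫ θ, f θ ∂ξ = ∫ t in Set.Ioc 0 b, ξ.real {θ | t ≤ f θ} := by
    refine Integrable.integral_eq_integral_Ioc_meas_le ?_ (ae_of_all _ h0) (ae_of_all _ h1)
    exact Integrable.of_bound hf.aestronglyMeasurable b
      (ae_of_all _ fun θ => by rw [Real.norm_eq_abs, abs_of_nonneg (h0 θ)]; exact h1 θ)
  have int (ξ : Measure Θ) [IsProbabilityMeasure ξ] :
      IntegrableOn (fun t => ξ.real {θ | t ≤ f θ}) (Set.Ioc 0 b) := by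
    have anti : Antitone fun t => ξ.real {θ | t ≤ f θ} :=
      fun s t hst => measureReal_mono fun θ (hθ : t ≤ f θ) => hst.trans hθ
    exact Integrable.of_bound anti.measurable.aestronglyMeasurable 1
      (ae_of_all _ fun t => by
        rw [Real.norm_eq_abs, abs_of_nonneg measureReal_nonneg]; exact measureReal_le_one)
  rw [layer μ, layer ν, ← integral_sub (int μ) (int ν), ← Real.norm_eq_abs]
  refine (norm_setIntegral_le_of_norm_le_const (C := tvDist μ ν) (by simp) fun t _ => ?_).trans
    (by simp [hb, mul_comm])
  exact abs_sub_le_tvDist μ ν (measurableSet_le measurable_const hf)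

end TotalVariation

/-! ### Markov kernels and total variation -/

section Markov

variable {Θ : Type*} [MeasurableSpace Θ]

theorem measureReal_bind (μ : Measure Θ) (κ : Kernel Θ Θ) [IsMarkovKernel κ] {A : Set Θ}
    (hA : MeasurableSet A) : (μ.bind κ).real A = ∫ θ, (κ θ).real A ∂μ := by
  rw [measureReal_def, Measure.bind_apply hA κ.aemeasurable]
  exact (integral_toReal (κ.measurable_coe hA).aemeasurable
    (ae_of_all _ fun θ => measure_lt_top _ _)).symm

theorem measurable_kernel_real (κ : Kernel Θ Θ) {A : Set Θ} (hA : MeasurableSet A) :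
    Measurable fun θ => (κ θ).real A := (κ.measurable_coe hA).ennreal_toReal

theorem tvDist_bind_le (μ ν : Measure Θ) [IsProbabilityMeasure μ] [IsProbabilityMeasure ν]
    (κ : Kernel Θ Θ) [IsMarkovKernel κ] : tvDist (μ.bind κ) (ν.bind κ) ≤ tvDist μ ν := by
  refine tvDist_le fun A hA => ?_
  rw [measureReal_bind μ κ hA, measureReal_bind ν κ hA]
  simpa using abs_integral_sub_le_tvDist μ ν (measurable_kernel_real κ hA) zero_le_one
    (fun _ => measureReal_nonneg) (fun _ => measureReal_le_one)

instance isMarkovKernel_pow (κ : Kernel Θ Θ) [IsMarkovKernel κ] (n : ℕ) :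
    IsMarkovKernel (κ ^ n) := by
  induction n with
  | zero => exact inferInstanceAs (IsMarkovKernel (Kernel.id : Kernel Θ Θ))
  | succ n ih => rw [_root_.pow_succ]; exact inferInstanceAs (IsMarkovKernel ((κ ^ n) ∘ₖ κ))

theorem bind_pow_succ (μ : Measure Θ) (κ : Kernel Θ Θ) (n : ℕ) :
    μ.bind ⇑(κ ^ (n + 1)) = (μ.bind κ).bind ⇑(κ ^ n) := Measure.comp_assoc.symm

theorem bind_pow_succ' (μ : Measure Θ) (κ : Kernel Θ Θ) (n : ℕ) :
    μ.bind ⇑(κ ^ (n + 1)) = (μ.bind ⇑(κ ^ n)).bind κ := by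
  rw [_root_.pow_succ']
  exact Measure.comp_assoc.symm

theorem bind_pow_zero (μ : Measure Θ) (κ : Kernel Θ Θ) : μ.bind ⇑(κ ^ 0) = μ := by
  rw [_root_.pow_zero]
  exact Measure.id_comp

theorem invariant_pow {κ : Kernel Θ Θ} {μ : Measure Θ} (h : κ.Invariant μ) (n : ℕ) :
    (κ ^ n).Invariant μ := by
  induction n with
  | zero => exact bind_pow_zero μ κ
  | succ n ih =>
    rw [Kernel.Invariant, bind_pow_succ, h]
    exact ih

/-- Telescoping: a Markov kernel does not increase total variation, so each further step costs at
most the one-step discrepancy. -/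
theorem tvDist_bind_pow_le (μ : Measure Θ) [IsProbabilityMeasure μ] (κ : Kernel Θ Θ)
    [IsMarkovKernel κ] (n : ℕ) : tvDist (μ.bind ⇑(κ ^ n)) μ ≤ n * tvDist (μ.bind κ) μ := by
  induction n with
  | zero => rw [bind_pow_zero, tvDist_self]; simp
  | succ n ih =>
    rw [bind_pow_succ']
    have h1 := tvDist_triangle ((μ.bind ⇑(κ ^ n)).bind κ) (μ.bind κ) μ
    have h2 := tvDist_bind_le (μ.bind ⇑(κ ^ n)) μ κ
    push_cast
    linarith

end Markov

/-! ### Consequences of a minorisation -/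

section Minorisation

variable {Θ : Type*} [MeasurableSpace Θ] {K : Kernel Θ Θ}
  {c : ℝ} {ν : Measure Θ} [IsProbabilityMeasure ν]

/-- The part of a minorised kernel that remains after removing the common component. -/
def residual (K : Kernel Θ Θ) (c : ℝ) (ν : Measure Θ) [IsProbabilityMeasure ν]
    (h : ∀ θ A, MeasurableSet A → ENNReal.ofReal c * ν A ≤ K θ A) : Kernel Θ Θ where
  toFun θ := K θ - ENNReal.ofReal c • ν
  measurable' := by
    have hle (θ : Θ) : ENNReal.ofReal c • ν ≤ K θ := Measure.le_iff.2 fun A hA => by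
      simpa using h θ A hA
    have : IsFiniteMeasure (ENNReal.ofReal c • ν) := ν.smul_finite ENNReal.ofReal_ne_top
    refine Measure.measurable_of_measurable_coe _ fun s hs => ?_
    simp only [Measure.sub_apply hs (hle _)]
    exact (K.measurable_coe hs).sub_const _

theorem residual_add (h : ∀ θ A, MeasurableSet A → ENNReal.ofReal c * ν A ≤ K θ A) :
    K = residual K c ν h + Kernel.const Θ (ENNReal.ofReal c • ν) := by
  have : IsFiniteMeasure (ENNReal.ofReal c • ν) := ν.smul_finite ENNReal.ofReal_ne_top
  ext θ : 1
  exact (Measure.sub_add_cancel_of_le (Measure.le_iff.2 fun A hA => by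
      simpa using h θ A hA)).symm

variable [IsMarkovKernel K]

/-- Subtracting the constant `c * ν A` from `θ ↦ K θ A` does not affect the difference of the
integrals and leaves a function with values in `[0, 1 - c]`. -/
theorem tvDist_bind_le_of_minorised (hc0 : 0 < c) (hc1 : c < 1)
    (h : ∀ θ A, MeasurableSet A → ENNReal.ofReal c * ν A ≤ K θ A)
    (μ μ' : Measure Θ) [IsProbabilityMeasure μ] [IsProbabilityMeasure μ'] :
    tvDist (μ.bind K) (μ'.bind K) ≤ (1 - c) * tvDist μ μ' := by
  have hreal (θ : Θ) (A : Set Θ) (hA : MeasurableSet A) : c * ν.real A ≤ (K θ).real A := by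
    have := ENNReal.toReal_mono (measure_ne_top _ _) (h θ A hA)
    rwa [ENNReal.toReal_mul, ENNReal.toReal_ofReal hc0.le] at this
  refine tvDist_le fun A hA => ?_
  have hint (ξ : Measure Θ) [IsProbabilityMeasure ξ] :
      ∫ θ, ((K θ).real A - c * ν.real A) ∂ξ = (ξ.bind K).real A - c * ν.real A := by
    rw [measureReal_bind ξ K hA, integral_sub _ (integrable_const _)]
    · simp
    · exact Integrable.of_bound (measurable_kernel_real K hA).aestronglyMeasurable 1
        (ae_of_all _ fun t => by
          rw [Real.norm_eq_abs, abs_of_nonneg measureReal_nonneg]; exact measureReal_le_one)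
  have key := abs_integral_sub_le_tvDist μ μ' (f := fun θ => (K θ).real A - c * ν.real A)
    ((measurable_kernel_real K hA).sub_const _) (b := 1 - c) (by linarith)
    (fun θ => by linarith [hreal θ A hA]) (fun θ => by
      -- The upper bound is the minorisation of the complement.
      have h1 := hreal θ Aᶜ hA.compl
      rw [probReal_compl_eq_one_sub hA, probReal_compl_eq_one_sub hA] at h1
      linarith)
  rw [hint, hint] at key
  simpa using key

theorem residual_univ (h : ∀ θ A, MeasurableSet A → ENNReal.ofReal c * ν A ≤ K θ A) (θ : Θ) :
    residual K c ν h θ Set.univ = 1 - ENNReal.ofReal c := by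
  have h1 : K θ Set.univ = residual K c ν h θ Set.univ + ENNReal.ofReal c := by
    conv_lhs => rw [residual_add h]
    simp
  rw [measure_univ] at h1
  rw [h1, ENNReal.add_sub_cancel_right ENNReal.ofReal_ne_top]

/-- Regeneration: the invariant law is the explicit series `c * ∑ ν R^k`, with `R` the residual.
Since `R` has mass `1 - c` from every point, the geometric series gives total mass 1. -/
theorem exists_invariant_of_minorised (hc0 : 0 < c) (hc1 : c < 1)
    (h : ∀ θ A, MeasurableSet A → ENNReal.ofReal c * ν A ≤ K θ A) :
    ∃ π : Measure Θ, IsProbabilityMeasure π ∧ K.Invariant π := by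
  set R := residual K c ν h with hR
  set S : Measure Θ := Measure.sum fun k : ℕ => ν.bind ⇑(R ^ k) with hS
  have hmass (k : ℕ) : ν.bind ⇑(R ^ k) Set.univ = (1 - ENNReal.ofReal c) ^ k := by
    induction k with
    | zero => rw [bind_pow_zero]; simp
    | succ k ih =>
      rw [bind_pow_succ', Measure.bind_apply .univ R.aemeasurable]
      simp only [hR, residual_univ h, lintegral_const]
      rw [← hR, ih, _root_.pow_succ']
  have hprob : (ENNReal.ofReal c • S) Set.univ = 1 := by
    rw [Measure.smul_apply, hS, Measure.sum_apply _ .univ]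
    simp only [hmass, ENNReal.tsum_geometric, smul_eq_mul]
    rw [ENNReal.sub_sub_cancel ENNReal.one_ne_top (by simpa using hc1.le)]
    exact ENNReal.mul_inv_cancel (by simpa using hc0) ENNReal.ofReal_ne_top
  refine ⟨ENNReal.ofReal c • S, ⟨hprob⟩, ?_⟩
  -- Splitting off the zeroth term gives `S = ν + S R`. As `K` is `R` plus the constant kernel `c
  -- ν`, and `c S` has mass 1, `(c S) K = c S R + c ν = c S`.
  have hSR : S = ν + S.bind R := by
    rw [hS, Measure.bind_sum _ _ R.aemeasurable]
    simp only [← bind_pow_succ']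
    ext A hA
    rw [Measure.add_apply, Measure.sum_apply _ hA, Measure.sum_apply _ hA,
      tsum_eq_zero_add' ENNReal.summable, bind_pow_zero]
  have hKR : K = R + Kernel.const Θ (ENNReal.ofReal c • ν) := residual_add h
  rw [Kernel.Invariant]
  conv_lhs => rw [hKR]
  rw [Measure.add_comp, Measure.const_comp, hprob, one_smul, Measure.comp_smul, ← smul_add,
    add_comm, ← hSR]

theorem eq_of_invariant_of_minorised (hc0 : 0 < c) (hc1 : c < 1)
    (h : ∀ θ A, MeasurableSet A → ENNReal.ofReal c * ν A ≤ K θ A)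
    {μ μ' : Measure Θ} [IsProbabilityMeasure μ] [IsProbabilityMeasure μ']
    (hμ : K.Invariant μ) (hμ' : K.Invariant μ') : μ = μ' := by
  have := tvDist_bind_le_of_minorised hc0 hc1 h μ μ'
  rw [hμ, hμ'] at this
  exact eq_of_tvDist_le_zero (by nlinarith)

end Minorisation

/-! ### Ergodicity and perturbation when a power of the kernel is minorised. -/

section Ergodic

variable {Θ : Type*} [MeasurableSpace Θ] {κ : Kernel Θ Θ} [IsMarkovKernel κ]
  {n₀ : ℕ} {c : ℝ} {ν : Measure Θ} [IsProbabilityMeasure ν]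

theorem tvDist_pow_le_of_minorised (hc0 : 0 < c) (hc1 : c < 1)
    (h : ∀ θ A, MeasurableSet A → ENNReal.ofReal c * ν A ≤ (κ ^ n₀) θ A)
    {π : Measure Θ} [IsProbabilityMeasure π] (hπ : κ.Invariant π) (q r : ℕ) (θ : Θ) :
    tvDist ((κ ^ (n₀ * q + r)) θ) π ≤ (1 - c) ^ q := by
  induction q with
  | zero => simpa using tvDist_le_one ((κ ^ r) θ) π
  | succ q ih =>
    have h1 : (κ ^ (n₀ * (q + 1) + r)) θ = ((κ ^ (n₀ * q + r)) θ).bind ⇑(κ ^ n₀) := by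
      rw [show n₀ * (q + 1) + r = n₀ + (n₀ * q + r) by ring, Kernel.pow_add, Kernel.comp_apply]
    have h2 := tvDist_bind_le_of_minorised hc0 hc1 h ((κ ^ (n₀ * q + r)) θ) π
    rw [invariant_pow hπ n₀, ← h1] at h2
    rw [_root_.pow_succ']
    exact h2.trans (mul_le_mul_of_nonneg_left ih (by linarith))

theorem exists_uniformlyErgodic (hn : 1 ≤ n₀) (hc0 : 0 < c) (hc1 : c < 1)
    (h : ∀ θ A, MeasurableSet A → ENNReal.ofReal c * ν A ≤ (κ ^ n₀) θ A) :
    ∃ π : Measure Θ, UniformlyErgodic κ π ∧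
      ∀ μ : Measure Θ, IsProbabilityMeasure μ → κ.Invariant μ → μ = π := by
  obtain ⟨π, hprob, hinv⟩ := exists_invariant_of_minorised hc0 hc1 h
  have hπ : κ.Invariant π := by
    -- The image of `π` under `κ` is again invariant under `κ ^ n₀`, because `κ` commutes with its
    -- powers; uniqueness identifies it with `π`.
    refine eq_of_invariant_of_minorised hc0 hc1 h ?_ hinv
    rw [Kernel.Invariant, ← bind_pow_succ, bind_pow_succ', hinv]
  -- The rate is the `n₀`-th root of the contraction factor; the constant `(1 - c)⁻¹` pays for
  -- rounding `n / n₀` down.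
  refine ⟨π, ⟨hprob, hπ, (1 - c)⁻¹, (1 - c) ^ ((n₀ : ℝ)⁻¹), ?_, ?_, fun n θ => ?_⟩,
    fun μ hμ hμi => eq_of_invariant_of_minorised hc0 hc1 h (invariant_pow hμi n₀) hinv⟩
  · exact Real.rpow_nonneg (by linarith) _
  · exact Real.rpow_lt_one (by linarith) (by linarith) (by positivity)
  · set ρ : ℝ := (1 - c) ^ ((n₀ : ℝ)⁻¹) with hρ
    have hρn : ρ ^ n₀ = 1 - c := Real.rpow_inv_natCast_pow (by linarith) (by omega)
    have hρ0 : 0 ≤ ρ := Real.rpow_nonneg (by linarith) _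
    have hρ1 : ρ ≤ 1 := Real.rpow_le_one (by linarith) (by linarith) (by positivity)
    have h1 := tvDist_pow_le_of_minorised hc0 hc1 h hπ (n / n₀) (n % n₀) θ
    rw [Nat.div_add_mod] at h1
    have h2 : (1 - c) * (1 - c) ^ (n / n₀) ≤ ρ ^ n := by
      rw [← _root_.pow_succ', ← hρn, ← pow_mul]
      exact pow_le_pow_of_le_one hρ0 hρ1 (Nat.lt_mul_div_succ n (by omega)).le
    refine h1.trans ?_
    rw [inv_mul_eq_div, le_div_iff₀ (by linarith)]
    linarith

/-- Here `π` need not be invariant. The triangle inequality through `π κ^n₀` bounds the distance by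
`1 - c` times itself plus `n₀` one-step discrepancies; solve for the distance. -/
theorem tvDist_invariant_le (hc0 : 0 < c) (hc1 : c < 1)
    (h : ∀ θ A, MeasurableSet A → ENNReal.ofReal c * ν A ≤ (κ ^ n₀) θ A)
    {μ π : Measure Θ} [IsProbabilityMeasure μ] [IsProbabilityMeasure π] (hμ : κ.Invariant μ) :
    tvDist μ π ≤ n₀ / c * tvDist (π.bind κ) π := by
  have h1 := tvDist_bind_le_of_minorised hc0 hc1 h μ π
  rw [invariant_pow hμ n₀] at h1
  have h2 := tvDist_triangle μ (π.bind ⇑(κ ^ n₀)) π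
  have h3 := tvDist_bind_pow_le π κ n₀
  rw [div_mul_eq_mul_div, le_div_iff₀ hc0]
  linarith

end Ergodic

end SubsampledMH

namespace SubsampledMH

/-! ### Positivity of the p-value -/

theorem studentPDF_pos {ν : ℕ} (hν : 1 ≤ ν) (x : ℝ) : 0 < studentPDF ν x := by
  have hν' : (0 : ℝ) < ν := by exact_mod_cast hν
  have h1 := Real.Gamma_pos_of_pos (show (0 : ℝ) < ((ν : ℝ) + 1) / 2 by positivity)
  have h2 := Real.Gamma_pos_of_pos (show (0 : ℝ) < (ν : ℝ) / 2 by positivity)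
  have h3 := Real.pi_pos
  unfold studentPDF
  positivity

theorem measurable_studentPDF (ν : ℕ) : Measurable (studentPDF ν) := by
  unfold studentPDF
  fun_prop

/-- The exponent is at most `-1`, so a multiple of the Cauchy density dominates. Finiteness matters
because `toReal` would send an infinite tail to 0. -/
theorem integrable_studentPDF {ν : ℕ} (hν : 1 ≤ ν) : Integrable (studentPDF ν) := by
  have hν' : (1 : ℝ) ≤ ν := by exact_mod_cast hν
  have hν0 : (0 : ℝ) < ν := by linarith
  have key : Integrable fun x : ℝ => (1 + x ^ 2 / ν) ^ (-(((ν : ℝ) + 1) / 2)) := by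
    refine (integrable_inv_one_add_sq.const_mul (ν : ℝ)).mono'
      (by fun_prop : Measurable _).aestronglyMeasurable (ae_of_all _ fun x => ?_)
    have h1 : 1 ≤ 1 + x ^ 2 / ν := by
      have : 0 ≤ x ^ 2 / (ν : ℝ) := by positivity
      linarith
    rw [Real.norm_eq_abs, abs_of_nonneg (Real.rpow_nonneg (by linarith) _)]
    calc (1 + x ^ 2 / ν) ^ (-(((ν : ℝ) + 1) / 2)) ≤ (1 + x ^ 2 / ν) ^ (-1 : ℝ) :=
          Real.rpow_le_rpow_of_exponent_le h1 (by linarith)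
      _ = (1 + x ^ 2 / ν)⁻¹ := Real.rpow_neg_one _
      _ ≤ ((1 + x ^ 2) / ν)⁻¹ := by
          refine inv_anti₀ (by positivity) ?_
          rw [add_div]
          gcongr
          exact (div_le_one hν0).2 hν'
      _ = ν * (1 + x ^ 2)⁻¹ := by rw [inv_div, div_eq_mul_inv]
  exact key.const_mul _

theorem pValue_pos {ν : ℕ} (hν : 1 ≤ ν) (x : ℝ) : 0 < pValue ν x := by
  have hm : Measurable fun y => ENNReal.ofReal (studentPDF ν y) :=
    (measurable_studentPDF ν).ennreal_ofReal
  refine ENNReal.toReal_pos ?_ ?_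
  · rw [studentT, withDensity_apply _ measurableSet_Ioi, ← pos_iff_ne_zero]
    refine (setLIntegral_pos_iff hm).2 ?_
    rw [Set.inter_eq_right.2 fun y _ => by simpa using studentPDF_pos hν y]
    simp
  · refine ne_top_of_le_ne_top ?_ (measure_mono (Set.subset_univ _))
    rw [studentT, withDensity_apply _ .univ, Measure.restrict_univ]
    exact (integrable_studentPDF hν).lintegral_lt_top.ne

/-! ### Sample means -/

theorem sampleMean_self {N : ℕ} (l : Fin N → ℝ) (σ : Equiv.Perm (Fin N)) :
    sampleMean l σ N = (∑ i, l i) / N := by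
  unfold sampleMean
  rw [Finset.filter_true_of_mem fun i _ => i.isLt, Equiv.sum_comp σ l]

theorem sum_ite_val_lt {N n : ℕ} (h : n ≤ N) :
    (∑ i : Fin N, if i.val < n then (1 : ℝ) else 0) = n := by
  rw [Finset.sum_boole, Fin.card_filter_val_lt, min_eq_right h]

/-- Chebyshev's sum inequality for the increasing population and the decreasing indicator of the
first `n` positions. -/
theorem sampleMean_le_of_monotone {N n : ℕ} {l : Fin N → ℝ} {σ : Equiv.Perm (Fin N)}
    (h : Monotone (l ∘ σ)) (hn : 1 ≤ n) (hnN : n ≤ N) :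
    sampleMean l σ n ≤ (∑ i, l i) / N := by
  have hanti : Antitone fun i : Fin N => if i.val < n then (1 : ℝ) else 0 := by
    intro i j hij
    have : i.val ≤ j.val := hij
    dsimp only
    split_ifs <;> first | omega | norm_num
  have hc := (hanti.antivary h).card_mul_sum_le_sum_mul_sum
  simp only [sum_ite_val_lt hnN, Fintype.card_fin, ite_mul, one_mul, zero_mul,
    Function.comp_apply, Equiv.sum_comp σ l, ← Finset.sum_filter] at hc
  have hn0 : (0 : ℝ) < n := by exact_mod_cast hn
  have hN0 : (0 : ℝ) < N := by exact_mod_cast hn.trans hnN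
  unfold sampleMean
  rw [div_le_div_iff₀ hn0 hN0]
  linarith

theorem sampleMean_neg {N : ℕ} (l : Fin N → ℝ) (σ : Equiv.Perm (Fin N)) (n : ℕ) :
    sampleMean (-l) σ n = -sampleMean l σ n := by
  simp [sampleMean, neg_div]

theorem exists_perm_sampleMean_le {N : ℕ} (l : Fin N → ℝ) :
    ∃ σ : Equiv.Perm (Fin N), ∀ n, 1 ≤ n → n ≤ N → sampleMean l σ n ≤ (∑ i, l i) / N :=
  ⟨Tuple.sort l, fun _ h1 h2 => sampleMean_le_of_monotone (Tuple.monotone_sort l) h1 h2⟩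

theorem exists_perm_le_sampleMean {N : ℕ} (l : Fin N → ℝ) :
    ∃ σ : Equiv.Perm (Fin N), ∀ n, 1 ≤ n → n ≤ N → (∑ i, l i) / N ≤ sampleMean l σ n := by
  obtain ⟨σ, hσ⟩ := exists_perm_sampleMean_le (-l)
  refine ⟨σ, fun n h1 h2 => ?_⟩
  have := hσ n h1 h2
  rw [sampleMean_neg] at this
  simp only [Pi.neg_apply, Finset.sum_neg_distrib, neg_div] at this
  linarith

theorem sampleStd_one {N : ℕ} (l : Fin N → ℝ) (σ : Equiv.Perm (Fin N)) : sampleStd l σ 1 = 0 := by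
  simp [sampleStd]

/-! ### Outcome of the test -/

theorem one_le_numObserved {N m t : ℕ} (hN : 0 < N) (hm : 0 < m) (ht : 1 ≤ t) :
    1 ≤ numObserved N m t := le_min (Nat.mul_pos ht hm) hN

theorem numObserved_le (N m t : ℕ) : numObserved N m t ≤ N := min_le_right _ _

theorem exists_first_stopping {N m : ℕ} (hN : 0 < N) (hm : 0 < m) (ε μ₀ : ℝ) (l : Fin N → ℝ)
    (σ : Equiv.Perm (Fin N)) :
    ∃ t, 1 ≤ t ∧ Stops m ε μ₀ l σ t ∧ ∀ r, 1 ≤ r → r < t → ¬ Stops m ε μ₀ l σ r := by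
  classical
  have hex : ∃ t, 1 ≤ t ∧ Stops m ε μ₀ l σ t :=
    -- Batches are nonempty, so `N` of them exhaust the population.
    ⟨N, hN, Or.inl (min_eq_right (Nat.le_mul_of_pos_right N hm))⟩
  exact ⟨Nat.find hex, (Nat.find_spec hex).1, (Nat.find_spec hex).2,
    fun r h1 h2 h3 => Nat.find_min hex h2 ⟨h1, h3⟩⟩

theorem testAccepts_of_forall_lt {N m : ℕ} (hN : 0 < N) (hm : 0 < m) (ε : ℝ) {μ₀ : ℝ}
    {l : Fin N → ℝ} {σ : Equiv.Perm (Fin N)}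
    (h : ∀ n, 1 ≤ n → n ≤ N → μ₀ < sampleMean l σ n) : TestAccepts m ε μ₀ l σ := by
  obtain ⟨t, ht, hs, hr⟩ := exists_first_stopping hN hm ε μ₀ l σ
  exact ⟨t, ht, hs, hr, h _ (one_le_numObserved hN hm ht) (numObserved_le _ _ _)⟩

theorem not_testAccepts_of_forall_le {N m : ℕ} (hN : 0 < N) (hm : 0 < m) (ε : ℝ) {μ₀ : ℝ}
    {l : Fin N → ℝ} {σ : Equiv.Perm (Fin N)}
    (h : ∀ n, 1 ≤ n → n ≤ N → sampleMean l σ n ≤ μ₀) : ¬ TestAccepts m ε μ₀ l σ := by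
  rintro ⟨t, ht, -, -, hlt⟩
  exact hlt.not_ge (h _ (one_le_numObserved hN hm ht) (numObserved_le _ _ _))

theorem testAcceptProb_nonneg {N : ℕ} (m : ℕ) (ε μ₀ : ℝ) (l : Fin N → ℝ) :
    0 ≤ testAcceptProb m ε μ₀ l := by
  classical
  unfold testAcceptProb
  exact div_nonneg (Finset.sum_nonneg fun σ _ => by split_ifs <;> norm_num) (by positivity)

theorem one_sub_testAcceptProb {N : ℕ} (m : ℕ) (ε μ₀ : ℝ) (l : Fin N → ℝ)
    [∀ σ, Decidable (TestAccepts m ε μ₀ l σ)] :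
    1 - testAcceptProb m ε μ₀ l =
      (∑ σ : Equiv.Perm (Fin N), if TestAccepts m ε μ₀ l σ then (0 : ℝ) else 1) /
        (N.factorial : ℝ) := by
  have hf : (0 : ℝ) < N.factorial := by exact_mod_cast N.factorial_pos
  have hsum : (∑ σ : Equiv.Perm (Fin N), if TestAccepts m ε μ₀ l σ then (0 : ℝ) else 1) +
      (∑ σ : Equiv.Perm (Fin N), if TestAccepts m ε μ₀ l σ then (1 : ℝ) else 0) =
        N.factorial := by
    rw [← Finset.sum_add_distrib, Finset.sum_congr rfl (g := fun _ => (1 : ℝ))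
      fun σ _ => by split_ifs <;> norm_num]
    simp [Fintype.card_perm]
  unfold testAcceptProb
  rw [eq_div_iff hf.ne', sub_mul, div_mul_cancel₀ _ hf.ne', one_mul, sub_eq_iff_eq_add, ← hsum]
  congr!

theorem testAcceptProb_le_one {N : ℕ} (m : ℕ) (ε μ₀ : ℝ) (l : Fin N → ℝ) :
    testAcceptProb m ε μ₀ l ≤ 1 := by
  classical
  rw [← sub_nonneg, one_sub_testAcceptProb]
  exact div_nonneg (Finset.sum_nonneg fun σ _ => by split_ifs <;> norm_num) (by positivity)

/-- In decreasing order of the population all sample means are at least the population mean, so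
that the test accepts whenever the exact decision is to accept. -/
theorem inv_factorial_le_testAcceptProb {N m : ℕ} (hN : 0 < N) (hm : 0 < m) (ε : ℝ) {μ₀ : ℝ}
    {l : Fin N → ℝ} (h : μ₀ < (∑ i, l i) / N) :
    (N.factorial : ℝ)⁻¹ ≤ testAcceptProb m ε μ₀ l := by
  classical
  obtain ⟨σ, hσ⟩ := exists_perm_le_sampleMean l
  have hacc : TestAccepts m ε μ₀ l σ :=
    testAccepts_of_forall_lt hN hm ε fun n h1 h2 => h.trans_le (hσ n h1 h2)
  unfold testAcceptProb
  rw [inv_eq_one_div]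
  gcongr
  refine le_trans ?_ (Finset.single_le_sum
    (f := fun σ => if TestAccepts m ε μ₀ l σ then (1 : ℝ) else 0)
    (fun σ _ => by split_ifs <;> norm_num) (Finset.mem_univ σ))
  simp [hacc]

/-- In increasing order of the population all sample means are at most the population mean, so
that the test rejects whenever the exact decision is to reject. -/
theorem inv_factorial_le_one_sub_testAcceptProb {N m : ℕ} (hN : 0 < N) (hm : 0 < m) (ε : ℝ)
    {μ₀ : ℝ} {l : Fin N → ℝ} (h : (∑ i, l i) / N ≤ μ₀) :
    (N.factorial : ℝ)⁻¹ ≤ 1 - testAcceptProb m ε μ₀ l := by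
  classical
  obtain ⟨σ, hσ⟩ := exists_perm_sampleMean_le l
  have hrej : ¬ TestAccepts m ε μ₀ l σ :=
    not_testAccepts_of_forall_le hN hm ε fun n h1 h2 => (hσ n h1 h2).trans h
  rw [one_sub_testAcceptProb, inv_eq_one_div]
  gcongr
  refine le_trans ?_ (Finset.single_le_sum
    (f := fun σ => if TestAccepts m ε μ₀ l σ then (0 : ℝ) else 1)
    (fun σ _ => by split_ifs <;> norm_num) (Finset.mem_univ σ))
  simp [hrej]

/-- For small tolerances the test does not stop before it has observed the whole population. -/
theorem eventually_stops_imp {N m : ℕ} (hN : 0 < N) (hm : 0 < m) (μ₀ : ℝ) (l : Fin N → ℝ)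
    (σ : Equiv.Perm (Fin N)) :
    ∀ᶠ ε in 𝓝[>] (0 : ℝ), ∀ t, 1 ≤ t → Stops m ε μ₀ l σ t → numObserved N m t = N := by
  -- Positivity of the p-value needs a degree of freedom, hence `n ≥ 2`; for `n = 1` the clause
  -- `sampleStd ≠ 0` already forbids stopping. Only finitely many sizes occur, so one bound on `ε`
  -- serves all.
  have h1 : ∀ n ∈ Set.Icc 2 N, ∀ᶠ ε in 𝓝[>] (0 : ℝ),
      ε < pValue (n - 1) ((sampleMean l σ n - μ₀) / stdOfMean l σ n) := fun n hn =>
    (eventually_lt_nhds (pValue_pos (Nat.le_sub_one_of_lt hn.1) _)).filter_mono nhdsWithin_le_nhds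
  filter_upwards [(eventually_all_finite (Set.finite_Icc 2 N)).2 h1] with ε hε t ht hs
  refine hs.resolve_right fun ⟨hstd, hp⟩ => ?_
  have hn1 := one_le_numObserved hN hm ht
  have hne : numObserved N m t ≠ 1 := fun h => hstd (by rw [h, sampleStd_one])
  exact hp.not_gt (hε _ ⟨by omega, numObserved_le _ _ _⟩)

theorem eventually_testAcceptProb_eq {N m : ℕ} (hN : 0 < N) (hm : 0 < m) (μ₀ : ℝ)
    (l : Fin N → ℝ) :
    ∀ᶠ ε in 𝓝[>] (0 : ℝ),
      testAcceptProb m ε μ₀ l = if μ₀ < (∑ i, l i) / N then 1 else 0 := by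
  classical
  have hf : (N.factorial : ℝ) ≠ 0 := by exact_mod_cast N.factorial_ne_zero
  filter_upwards [eventually_all.2 (eventually_stops_imp hN hm μ₀ l)] with ε hε
  have hiff (σ : Equiv.Perm (Fin N)) : TestAccepts m ε μ₀ l σ ↔ μ₀ < (∑ i, l i) / N := by
    constructor
    · rintro ⟨t, ht, hs, -, hlt⟩
      rwa [hε σ t ht hs, sampleMean_self] at hlt
    · intro hlt
      obtain ⟨t, ht, hs, hr⟩ := exists_first_stopping hN hm ε μ₀ l σ
      exact ⟨t, ht, hs, hr, by rwa [hε σ t ht hs, sampleMean_self]⟩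
  unfold testAcceptProb
  simp only [hiff]
  split_ifs
  · simp [Fintype.card_perm, hf]
  · simp

end SubsampledMH

namespace SubsampledMH

namespace Model

variable {Θ ι : Type*} [MeasurableSpace Θ] {N : ℕ} (M : Model Θ ι N)

/-! ### Acceptance probabilities -/

section Accept

theorem wNode_pos (a : ι) (θ θ' : Θ) : 0 < M.wNode a θ θ' :=
  div_pos (M.lik_pos a θ') (M.lik_pos a θ)

theorem wVar_eq (θ θ' : Θ) :
    M.wVar θ θ' = M.prior θ' * M.prop θ' θ / (M.prior θ * M.prop θ θ') := by
  unfold wVar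
  rw [div_mul_div_comm, mul_comm (M.prop θ θ')]

theorem wVar_nonneg (θ θ' : Θ) : 0 ≤ M.wVar θ θ' := by
  rw [wVar_eq]
  exact div_nonneg (mul_nonneg (M.prior_nonneg _) (M.prop_nonneg _ _))
    (mul_nonneg (M.prior_nonneg _) (M.prop_nonneg _ _))

variable [Fintype ι]

theorem prod_wNode_pos (θ θ' : Θ) : 0 < ∏ a, M.wNode a θ θ' :=
  Finset.prod_pos fun a _ => M.wNode_pos a θ θ'

theorem acceptProb_nonneg (θ θ' : Θ) : 0 ≤ M.acceptProb θ θ' := by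
  unfold acceptProb
  split_ifs
  · exact zero_le_one
  · exact le_min zero_le_one (mul_nonneg (M.wVar_nonneg _ _) (M.prod_wNode_pos _ _).le)

theorem acceptProb_le_one (θ θ' : Θ) : M.acceptProb θ θ' ≤ 1 := by
  unfold acceptProb
  split_ifs
  · exact le_rfl
  · exact min_le_left _ _

/-- Take logarithms and group the nodes by section. Positivity of the weight and of `u` is essential
because `Real.log 0 = 0`. -/
theorem threshold_lt_iff (hN : 0 < N) {θ θ' : Θ} (hw : 0 < M.wVar θ θ') {u : ℝ} (hu : 0 < u) :
    M.threshold θ θ' u < (∑ i, M.localLog θ θ' i) / N ↔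
      u < M.wVar θ θ' * ∏ a, M.wNode a θ θ' := by
  classical
  have hN' : (0 : ℝ) < N := by exact_mod_cast hN
  have hp := M.prod_wNode_pos θ θ'
  have hsplit : ∑ a, Real.log (M.wNode a θ θ') =
      (∑ a with M.sec a = none, Real.log (M.wNode a θ θ')) + ∑ i, M.localLog θ θ' i := by
    rw [← Finset.sum_fiberwise Finset.univ M.sec, Fintype.sum_option]
    rfl
  rw [← Real.log_lt_log_iff hu (mul_pos hw hp), Real.log_mul hw.ne' hp.ne',
    Real.log_prod fun a _ => (M.wNode_pos a θ θ').ne', hsplit]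
  unfold threshold
  rw [div_lt_div_iff_of_pos_right hN']
  constructor <;> intro h <;> linarith

theorem integral_Ioc_ite_lt {w : ℝ} (hw : 0 ≤ w) :
    ∫ u in Set.Ioc (0 : ℝ) 1, (if u < w then (1 : ℝ) else 0) = min 1 w := by
  have h1 : (fun u : ℝ => if u < w then (1 : ℝ) else 0) = (Set.Iio w).indicator fun _ => 1 := by
    ext u
    simp [Set.indicator_apply]
  rw [h1, setIntegral_indicator measurableSet_Iio, setIntegral_const, smul_eq_mul, mul_one]
  rcases le_or_gt w 1 with h | h
  · have : Set.Ioc 0 1 ∩ Set.Iio w = Set.Ioo 0 w := by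
      ext u
      simp only [Set.mem_inter_iff, Set.mem_Ioc, Set.mem_Iio, Set.mem_Ioo]
      exact ⟨fun hu => ⟨hu.1.1, hu.2⟩, fun hu => ⟨⟨hu.1, hu.2.le.trans h⟩, hu.2⟩⟩
    rw [this, min_eq_right h, Real.volume_real_Ioo_of_le hw, sub_zero]
  · rw [Set.inter_eq_left.2 fun u hu => hu.2.trans_lt h, min_eq_left h.le]
    simp

/-- Where both weights are positive, the exact acceptance probability is the probability that the
mean of the whole population exceeds the threshold. -/
theorem acceptProb_eq_integral (hN : 0 < N) {θ θ' : Θ} (h1 : M.prior θ * M.prop θ θ' ≠ 0)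
    (h2 : M.prior θ' * M.prop θ' θ ≠ 0) :
    M.acceptProb θ θ' = ∫ u in Set.Ioc (0 : ℝ) 1,
      (if M.threshold θ θ' u < (∑ i, M.localLog θ θ' i) / N then (1 : ℝ) else 0) := by
  have hw : 0 < M.wVar θ θ' :=
    lt_of_le_of_ne (M.wVar_nonneg _ _) (by rw [wVar_eq]; exact (div_ne_zero h2 h1).symm)
  rw [acceptProb, if_neg h1,
    ← integral_Ioc_ite_lt (mul_nonneg hw.le (M.prod_wNode_pos θ θ').le)]
  refine setIntegral_congr_fun measurableSet_Ioc fun u hu => ?_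
  simp only [M.threshold_lt_iff hN hw hu.1]

theorem acceptProb_eq_zero {θ θ' : Θ} (h1 : M.prior θ * M.prop θ θ' ≠ 0)
    (h2 : M.prior θ' * M.prop θ' θ = 0) : M.acceptProb θ θ' = 0 := by
  rw [acceptProb, if_neg h1, wVar_eq, h2]
  simp

theorem integrableOn_test (m : ℕ) (ε : ℝ) (θ θ' : Θ) :
    IntegrableOn (fun u => testAcceptProb m ε (M.threshold θ θ' u) (M.localLog θ θ'))
      (Set.Ioc 0 1) := by
  have hm : Measurable fun u => testAcceptProb m ε (M.threshold θ θ' u) (M.localLog θ θ') :=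
    measurable_testAcceptProb m ε
      (M.measurable_threshold.comp (measurable_prodMk_left (x := (θ, θ')))) measurable_const
  exact Integrable.of_bound hm.aestronglyMeasurable 1 (ae_of_all _ fun u => by
    rw [Real.norm_eq_abs, abs_of_nonneg (testAcceptProb_nonneg _ _ _ _)]
    exact testAcceptProb_le_one _ _ _ _)

theorem integrableOn_exact_test (θ θ' : Θ) :
    IntegrableOn (fun u => if M.threshold θ θ' u < (∑ i, M.localLog θ θ' i) / N
      then (1 : ℝ) else 0) (Set.Ioc 0 1) := by
  have hm : Measurable fun u => M.threshold θ θ' u :=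
    M.measurable_threshold.comp (measurable_prodMk_left (x := (θ, θ')))
  exact Integrable.of_bound (Measurable.ite (measurableSet_lt hm measurable_const)
    measurable_const measurable_const).aestronglyMeasurable 1
    (ae_of_all _ fun u => by split_ifs <;> simp)

theorem approxAcceptProb_nonneg (m : ℕ) (ε : ℝ) (θ θ' : Θ) : 0 ≤ M.approxAcceptProb m ε θ θ' := by
  unfold approxAcceptProb
  split_ifs
  · exact zero_le_one
  · exact le_rfl
  · exact integral_nonneg fun u => testAcceptProb_nonneg _ _ _ _

theorem integral_one_Ioc : ∫ _ in Set.Ioc (0 : ℝ) 1, (1 : ℝ) = 1 := by simp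

theorem approxAcceptProb_le_one (m : ℕ) (ε : ℝ) (θ θ' : Θ) : M.approxAcceptProb m ε θ θ' ≤ 1 := by
  unfold approxAcceptProb
  split_ifs
  · exact le_rfl
  · exact zero_le_one
  · exact (integral_mono (M.integrableOn_test m ε θ θ') (integrable_const 1)
      fun u => testAcceptProb_le_one _ _ _ _).trans integral_one_Ioc.le

/-- The bound from one favourable ordering is integrated over `u`; in the degenerate cases both
chains decide alike. -/
theorem inv_factorial_mul_acceptProb_le {m : ℕ} (hN : 0 < N) (hm : 0 < m) (ε : ℝ) (θ θ' : Θ) :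
    (N.factorial : ℝ)⁻¹ * M.acceptProb θ θ' ≤ M.approxAcceptProb m ε θ θ' := by
  have hf : (N.factorial : ℝ)⁻¹ ≤ 1 := inv_le_one_of_one_le₀ (by exact_mod_cast N.factorial_pos)
  by_cases h1 : M.prior θ * M.prop θ θ' = 0
  · simpa [acceptProb, approxAcceptProb, h1] using hf
  by_cases h2 : M.prior θ' * M.prop θ' θ = 0
  · rw [M.acceptProb_eq_zero h1 h2, mul_zero]
    exact M.approxAcceptProb_nonneg _ _ _ _
  rw [M.acceptProb_eq_integral hN h1 h2, approxAcceptProb, if_neg h1, if_neg h2,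
    ← integral_const_mul]
  refine integral_mono ((M.integrableOn_exact_test θ θ').const_mul _)
    (M.integrableOn_test m ε θ θ') fun u => ?_
  dsimp only
  split_ifs with h
  · rw [mul_one]
    exact inv_factorial_le_testAcceptProb hN hm ε h
  · rw [mul_zero]
    exact testAcceptProb_nonneg _ _ _ _

/-- Needed besides the acceptance bound, since the minorising component of the exact chain may use
the mass that stays put. -/
theorem inv_factorial_mul_one_sub_acceptProb_le {m : ℕ} (hN : 0 < N) (hm : 0 < m) (ε : ℝ)
    (θ θ' : Θ) :
    (N.factorial : ℝ)⁻¹ * (1 - M.acceptProb θ θ') ≤ 1 - M.approxAcceptProb m ε θ θ' := by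
  have hf : (N.factorial : ℝ)⁻¹ ≤ 1 := inv_le_one_of_one_le₀ (by exact_mod_cast N.factorial_pos)
  by_cases h1 : M.prior θ * M.prop θ θ' = 0
  · simp [acceptProb, approxAcceptProb, h1]
  by_cases h2 : M.prior θ' * M.prop θ' θ = 0
  · rw [M.acceptProb_eq_zero h1 h2]
    simpa [approxAcceptProb, h1, h2] using hf
  rw [M.acceptProb_eq_integral hN h1 h2, approxAcceptProb, if_neg h1, if_neg h2]
  have hi := M.integrableOn_exact_test θ θ'
  have hi' := M.integrableOn_test m ε θ θ'
  have hone : IntegrableOn (fun _ : ℝ => (1 : ℝ)) (Set.Ioc 0 1) := by simp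
  have e (f : ℝ → ℝ) (hf : IntegrableOn f (Set.Ioc 0 1)) :
      1 - ∫ u in Set.Ioc (0 : ℝ) 1, f u = ∫ u in Set.Ioc (0 : ℝ) 1, (1 - f u) := by
    rw [integral_sub hone hf, integral_one_Ioc]
  rw [e _ hi, e _ hi', ← integral_const_mul]
  refine integral_mono ((hone.sub hi).const_mul _) (hone.sub hi') fun u => ?_
  dsimp only [Pi.sub_apply]
  split_ifs with h
  · rw [sub_self, mul_zero]
    linarith [testAcceptProb_le_one m ε (M.threshold θ θ' u) (M.localLog θ θ')]
  · rw [sub_zero, mul_one]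
    exact inv_factorial_le_one_sub_testAcceptProb hN hm ε (not_lt.1 h)

theorem tendsto_approxAcceptProb {m : ℕ} (hN : 0 < N) (hm : 0 < m) (θ θ' : Θ) :
    Tendsto (fun ε => M.approxAcceptProb m ε θ θ') (𝓝[>] 0) (𝓝 (M.acceptProb θ θ')) := by
  by_cases h1 : M.prior θ * M.prop θ θ' = 0
  · simp [acceptProb, approxAcceptProb, h1]
  by_cases h2 : M.prior θ' * M.prop θ' θ = 0
  · rw [M.acceptProb_eq_zero h1 h2]
    simp [approxAcceptProb, h1, h2]
  rw [M.acceptProb_eq_integral hN h1 h2]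
  simp only [approxAcceptProb, if_neg h1, if_neg h2]
  refine tendsto_integral_filter_of_dominated_convergence (fun _ => 1)
    (Eventually.of_forall fun ε => (M.integrableOn_test m ε θ θ').aestronglyMeasurable)
    (Eventually.of_forall fun ε => ae_of_all _ fun u => ?_) (by simp)
    (ae_of_all _ fun u => ?_)
  · rw [Real.norm_eq_abs, abs_of_nonneg (testAcceptProb_nonneg _ _ _ _)]
    exact testAcceptProb_le_one _ _ _ _
  · exact tendsto_const_nhds.congr' ((eventually_testAcceptProb_eq hN hm _ _).mono
      fun ε h => h.symm)

end Accept

/-! ### Metropolis type kernels -/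

section Kernel

theorem integrable_prop (θ : Θ) : Integrable (M.prop θ) M.base := by
  refine ⟨(M.measurable_prop.comp measurable_prodMk_left).aestronglyMeasurable, ?_⟩
  rw [hasFiniteIntegral_iff_ofReal (ae_of_all _ (M.prop_nonneg θ)), M.lintegral_prop]
  exact ENNReal.one_lt_top

theorem integral_prop (θ : Θ) : ∫ θ', M.prop θ θ' ∂M.base = 1 := by
  rw [integral_eq_lintegral_of_nonneg_ae (ae_of_all _ (M.prop_nonneg θ))
    (M.integrable_prop θ).aestronglyMeasurable, M.lintegral_prop, ENNReal.toReal_one]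

theorem integrable_accept_mul_prop {β : Θ → Θ → ℝ} (hβ : Measurable (Function.uncurry β))
    (h0 : ∀ θ θ', 0 ≤ β θ θ') (h1 : ∀ θ θ', β θ θ' ≤ 1) (θ : Θ) :
    Integrable (fun θ' => β θ θ' * M.prop θ θ') M.base := by
  have hβθ : Measurable (β θ) := hβ.comp measurable_prodMk_left
  exact (M.integrable_prop θ).bdd_mul (c := 1) hβθ.aestronglyMeasurable (ae_of_all _ fun θ' => by
    rw [Real.norm_eq_abs, abs_of_nonneg (h0 _ _)]; exact h1 _ _)

theorem integrable_reject_mul_prop {β : Θ → Θ → ℝ} (hβ : Measurable (Function.uncurry β))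
    (h0 : ∀ θ θ', 0 ≤ β θ θ') (h1 : ∀ θ θ', β θ θ' ≤ 1) (θ : Θ) :
    Integrable (fun θ' => (1 - β θ θ') * M.prop θ θ') M.base :=
  M.integrable_accept_mul_prop (β := fun θ θ' => 1 - β θ θ')
    (hβ.const_sub 1 : Measurable fun p : Θ × Θ => 1 - β p.1 p.2)
    (fun θ θ' => sub_nonneg.2 (h1 θ θ')) (fun θ θ' => by linarith [h0 θ θ']) θ

variable {α α' : Θ → Θ → ℝ} (hα : Measurable (Function.uncurry α))
  (hα' : Measurable (Function.uncurry α'))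

theorem mhKernel_apply' (θ : Θ) {A : Set Θ} (hA : MeasurableSet A) :
    M.mhKernel α hα θ A = ∫⁻ θ' in A, ENNReal.ofReal (α θ θ' * M.prop θ θ') ∂M.base +
      (∫⁻ θ', ENNReal.ofReal ((1 - α θ θ') * M.prop θ θ') ∂M.base) * A.indicator 1 θ := by
  change (M.base.withDensity _ + _ • Measure.dirac θ) A = _
  rw [Measure.add_apply, withDensity_apply _ hA, Measure.smul_apply, Measure.dirac_apply' _ hA,
    smul_eq_mul]

theorem isMarkovKernel_mhKernel (h0 : ∀ θ θ', 0 ≤ α θ θ') (h1 : ∀ θ θ', α θ θ' ≤ 1) :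
    IsMarkovKernel (M.mhKernel α hα) := by
  refine ⟨fun θ => ⟨?_⟩⟩
  have hm : Measurable fun θ' => ENNReal.ofReal (α θ θ' * M.prop θ θ') :=
    ((hα.comp measurable_prodMk_left).mul
      (M.measurable_prop.comp measurable_prodMk_left)).ennreal_ofReal
  rw [M.mhKernel_apply' hα θ .univ, Measure.restrict_univ, Set.indicator_univ, Pi.one_apply,
    mul_one, ← lintegral_add_left hm, ← M.lintegral_prop θ]
  refine lintegral_congr fun θ' => ?_
  rw [← ENNReal.ofReal_add (mul_nonneg (h0 _ _) (M.prop_nonneg _ _))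
    (mul_nonneg (sub_nonneg.2 (h1 _ _)) (M.prop_nonneg _ _))]
  ring_nf

theorem mul_mhKernel_le {r : ℝ} (hr : 0 ≤ r) (h : ∀ θ θ', r * α θ θ' ≤ α' θ θ')
    (h' : ∀ θ θ', r * (1 - α θ θ') ≤ 1 - α' θ θ') (θ : Θ) {A : Set Θ} (hA : MeasurableSet A) :
    ENNReal.ofReal r * M.mhKernel α hα θ A ≤ M.mhKernel α' hα' θ A := by
  rw [M.mhKernel_apply' hα θ hA, M.mhKernel_apply' hα' θ hA, mul_add, ← mul_assoc,
    ← lintegral_const_mul' _ _ ENNReal.ofReal_ne_top,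
    ← lintegral_const_mul' _ _ ENNReal.ofReal_ne_top]
  gcongr with θ' θ'
  · rw [← ENNReal.ofReal_mul hr, ← mul_assoc]
    exact ENNReal.ofReal_le_ofReal (mul_le_mul_of_nonneg_right (h _ _) (M.prop_nonneg _ _))
  · rw [← ENNReal.ofReal_mul hr, ← mul_assoc]
    exact ENNReal.ofReal_le_ofReal (mul_le_mul_of_nonneg_right (h' _ _) (M.prop_nonneg _ _))

theorem mhKernel_real (h0 : ∀ θ θ', 0 ≤ α θ θ') (h1 : ∀ θ θ', α θ θ' ≤ 1) (θ : Θ) {A : Set Θ}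
    (hA : MeasurableSet A) :
    (M.mhKernel α hα θ).real A = ∫ θ' in A, α θ θ' * M.prop θ θ' ∂M.base +
      (∫ θ', (1 - α θ θ') * M.prop θ θ' ∂M.base) * A.indicator 1 θ := by
  have i1 := M.integrable_accept_mul_prop hα h0 h1 θ
  have i2 := M.integrable_reject_mul_prop hα h0 h1 θ
  have p1 (θ' : Θ) : 0 ≤ α θ θ' * M.prop θ θ' := mul_nonneg (h0 _ _) (M.prop_nonneg _ _)
  have p2 (θ' : Θ) : 0 ≤ (1 - α θ θ') * M.prop θ θ' :=
    mul_nonneg (sub_nonneg.2 (h1 _ _)) (M.prop_nonneg _ _)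
  rw [measureReal_def, M.mhKernel_apply' hα θ hA,
    ← ofReal_integral_eq_lintegral_ofReal i1.integrableOn (ae_of_all _ p1),
    ← ofReal_integral_eq_lintegral_ofReal i2 (ae_of_all _ p2),
    ENNReal.toReal_add ENNReal.ofReal_ne_top, ENNReal.toReal_mul,
    ENNReal.toReal_ofReal (integral_nonneg p1), ENNReal.toReal_ofReal (integral_nonneg p2)]
  · by_cases hθ : θ ∈ A <;> simp [hθ]
  · by_cases hθ : θ ∈ A <;> simp [hθ]

/-- Twice the mean absolute difference of two acceptance probabilities. -/
def acceptDiff (α α' : Θ → Θ → ℝ) (θ : Θ) : ℝ :=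
  2 * ∫ θ', |α θ θ' - α' θ θ'| * M.prop θ θ' ∂M.base

theorem measurable_acceptDiff (hα : Measurable (Function.uncurry α))
    (hα' : Measurable (Function.uncurry α')) : Measurable (M.acceptDiff α α') := by
  have := M.sigmaFinite_base
  have hm : Measurable fun p : Θ × Θ => |α p.1 p.2 - α' p.1 p.2| * M.prop p.1 p.2 :=
    (measurable_norm.comp (hα.sub hα')).mul M.measurable_prop
  exact (StronglyMeasurable.integral_prod_right' (ν := M.base)
    hm.stronglyMeasurable).measurable.const_mul 2

theorem acceptDiff_nonneg (θ : Θ) : 0 ≤ M.acceptDiff α α' θ :=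
  mul_nonneg zero_le_two
    (integral_nonneg fun _ => mul_nonneg (abs_nonneg _) (M.prop_nonneg _ _))

theorem integrable_abs_sub_mul_prop (hα : Measurable (Function.uncurry α))
    (hα' : Measurable (Function.uncurry α')) (hb : ∀ θ θ', |α θ θ' - α' θ θ'| ≤ 1) (θ : Θ) :
    Integrable (fun θ' => |α θ θ' - α' θ θ'| * M.prop θ θ') M.base :=
  M.integrable_accept_mul_prop (β := fun θ θ' => |α θ θ' - α' θ θ'|)
    (measurable_norm.comp (hα.sub hα')) (fun _ _ => abs_nonneg _) hb θ

theorem acceptDiff_le_two (hα : Measurable (Function.uncurry α))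
    (hα' : Measurable (Function.uncurry α')) (hb : ∀ θ θ', |α θ θ' - α' θ θ'| ≤ 1) (θ : Θ) :
    M.acceptDiff α α' θ ≤ 2 := by
  have : ∫ θ', |α θ θ' - α' θ θ'| * M.prop θ θ' ∂M.base ≤ ∫ θ', M.prop θ θ' ∂M.base :=
    integral_mono (M.integrable_abs_sub_mul_prop hα hα' hb θ) (M.integrable_prop θ)
      fun θ' => mul_le_of_le_one_left (M.prop_nonneg _ _) (hb _ _)
  rw [M.integral_prop] at this
  unfold acceptDiff
  linarith

/-- The factor 2 in `acceptDiff` counts the moved mass once and the atom at `θ` once. -/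
theorem abs_mhKernel_sub_le (h0 : ∀ θ θ', 0 ≤ α θ θ') (h1 : ∀ θ θ', α θ θ' ≤ 1)
    (h0' : ∀ θ θ', 0 ≤ α' θ θ') (h1' : ∀ θ θ', α' θ θ' ≤ 1) (θ : Θ) {A : Set Θ}
    (hA : MeasurableSet A) :
    |(M.mhKernel α hα θ).real A - (M.mhKernel α' hα' θ).real A| ≤ M.acceptDiff α α' θ := by
  have hb (θ θ' : Θ) : |α θ θ' - α' θ θ'| ≤ 1 := by
    rw [abs_le]
    constructor <;> linarith [h0 θ θ', h1 θ θ', h0' θ θ', h1' θ θ']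
  have i0 := M.integrable_abs_sub_mul_prop hα hα' hb θ
  have i1 := M.integrable_accept_mul_prop hα h0 h1 θ
  have i1' := M.integrable_accept_mul_prop hα' h0' h1' θ
  have i2 := M.integrable_reject_mul_prop hα h0 h1 θ
  have i2' := M.integrable_reject_mul_prop hα' h0' h1' θ
  have e1 : |∫ θ' in A, α θ θ' * M.prop θ θ' ∂M.base -
      ∫ θ' in A, α' θ θ' * M.prop θ θ' ∂M.base| ≤
        ∫ θ', |α θ θ' - α' θ θ'| * M.prop θ θ' ∂M.base := by
    rw [← integral_sub i1.integrableOn i1'.integrableOn]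
    refine abs_integral_le_integral_abs.trans ?_
    simp only [← sub_mul, abs_mul, abs_of_nonneg (M.prop_nonneg _ _)]
    exact setIntegral_le_integral i0
      (ae_of_all _ fun θ' => mul_nonneg (abs_nonneg _) (M.prop_nonneg _ _))
  have e2 : |∫ θ', (1 - α θ θ') * M.prop θ θ' ∂M.base -
      ∫ θ', (1 - α' θ θ') * M.prop θ θ' ∂M.base| ≤
        ∫ θ', |α θ θ' - α' θ θ'| * M.prop θ θ' ∂M.base := by
    rw [← integral_sub i2 i2']
    refine abs_integral_le_integral_abs.trans (le_of_eq (integral_congr_ae (ae_of_all _ fun θ' => ?_)))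
    dsimp only
    rw [← sub_mul, abs_mul, abs_of_nonneg (M.prop_nonneg _ _), sub_sub_sub_cancel_left,
      abs_sub_comm]
  have e3 : |A.indicator (1 : Θ → ℝ) θ| ≤ 1 := by by_cases hθ : θ ∈ A <;> simp [hθ]
  rw [M.mhKernel_real hα h0 h1 θ hA, M.mhKernel_real hα' h0' h1' θ hA, add_sub_add_comm,
    ← sub_mul]
  refine (abs_add_le _ _).trans ?_
  rw [abs_mul]
  have := mul_le_of_le_one_right (abs_nonneg (∫ θ', (1 - α θ θ') * M.prop θ θ' ∂M.base -
      ∫ θ', (1 - α' θ θ') * M.prop θ θ' ∂M.base)) e3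
  unfold acceptDiff
  linarith

end Kernel

end Model

/-- Chapman–Kolmogorov: each step loses one factor `r`. This carries a several-step Doeblin
condition from the exact to the approximate chain. -/
theorem pow_mul_kernel_pow_le {Θ : Type*} [MeasurableSpace Θ] {κ κ' : Kernel Θ Θ} {r : ℝ≥0∞}
    (hr : r ≠ ∞) (h : ∀ θ A, MeasurableSet A → r * κ θ A ≤ κ' θ A) (n : ℕ) (θ : Θ) {A : Set Θ}
    (hA : MeasurableSet A) : r ^ n * (κ ^ n) θ A ≤ (κ' ^ n) θ A := by
  induction n generalizing θ with
  | zero => simp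
  | succ n ih =>
    have hle : r • κ θ ≤ κ' θ := Measure.le_iff.2 fun B hB => by simpa using h θ B hB
    rw [add_comm n 1, Kernel.pow_add_apply_eq_lintegral _ _ _ _ hA,
      Kernel.pow_add_apply_eq_lintegral _ _ _ _ hA, _root_.pow_one, _root_.pow_one,
      _root_.pow_add, _root_.pow_one]
    calc r * r ^ n * ∫⁻ b, (κ ^ n) b A ∂κ θ
        = ∫⁻ b, r ^ n * (κ ^ n) b A ∂(r • κ θ) := by
          rw [lintegral_smul_measure, lintegral_const_mul' _ _ (ENNReal.pow_ne_top hr),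
            smul_eq_mul, mul_assoc]
      _ ≤ ∫⁻ b, r ^ n * (κ ^ n) b A ∂κ' θ := lintegral_mono' hle le_rfl
      _ ≤ ∫⁻ b, (κ' ^ n) b A ∂κ' θ := lintegral_mono fun b => ih b

end SubsampledMH

namespace SubsampledMH

namespace Model

variable {Θ ι : Type*} [MeasurableSpace Θ] [Fintype ι] {N : ℕ} (M : Model Θ ι N)

/-! ### The target distribution -/

theorem prod_lik_pos (θ : Θ) : 0 < ∏ a, M.lik a θ := Finset.prod_pos fun a _ => M.lik_pos a θ

theorem unnormDensity_nonneg (θ : Θ) : 0 ≤ M.unnormDensity θ :=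
  mul_nonneg (M.prior_nonneg θ) (M.prod_lik_pos θ).le

theorem measurable_unnormDensity : Measurable M.unnormDensity :=
  M.measurable_prior.mul (Finset.measurable_prod _ fun a _ => M.measurable_lik a)

theorem lintegral_unnormDensity_ne_zero :
    ∫⁻ θ, ENNReal.ofReal (M.unnormDensity θ) ∂M.base ≠ 0 := by
  intro h
  rw [lintegral_eq_zero_iff M.measurable_unnormDensity.ennreal_ofReal] at h
  have h1 : ∫⁻ θ, ENNReal.ofReal (M.prior θ) ∂M.base = 0 := by
    rw [lintegral_eq_zero_iff M.measurable_prior.ennreal_ofReal]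
    filter_upwards [h] with θ hθ
    simp only [Pi.zero_apply, ENNReal.ofReal_eq_zero] at hθ ⊢
    exact nonpos_of_mul_nonpos_left hθ (M.prod_lik_pos θ)
  exact one_ne_zero (M.lintegral_prior.symm.trans h1)

theorem lintegral_unnormDensity_ne_top {b : ℝ} (hb : ∀ θ, ∏ a, M.lik a θ ≤ b) :
    ∫⁻ θ, ENNReal.ofReal (M.unnormDensity θ) ∂M.base ≠ ∞ := by
  have h : ∫⁻ θ, ENNReal.ofReal (M.unnormDensity θ) ∂M.base ≤
      ∫⁻ θ, ENNReal.ofReal (M.prior θ) * ENNReal.ofReal b ∂M.base :=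
    lintegral_mono fun θ => by
      rw [← ENNReal.ofReal_mul (M.prior_nonneg θ)]
      exact ENNReal.ofReal_le_ofReal (mul_le_mul_of_nonneg_left (hb θ) (M.prior_nonneg θ))
  rw [lintegral_mul_const' _ _ ENNReal.ofReal_ne_top, M.lintegral_prior, one_mul] at h
  exact ne_top_of_le_ne_top ENNReal.ofReal_ne_top h

theorem isProbabilityMeasure_target {b : ℝ} (hb : ∀ θ, ∏ a, M.lik a θ ≤ b) :
    IsProbabilityMeasure M.target := by
  refine ⟨?_⟩
  rw [target, Measure.smul_apply, withDensity_apply _ .univ, Measure.restrict_univ, smul_eq_mul]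
  exact ENNReal.inv_mul_cancel M.lintegral_unnormDensity_ne_zero
    (M.lintegral_unnormDensity_ne_top hb)

/-- Detailed balance: when both proposal flows are nonzero, each side is their minimum. If just one
vanishes, the reverse move has acceptance probability 0, so the convention of accepting at a zero
denominator does no harm. -/
theorem unnormDensity_mul_acceptProb (θ θ' : Θ) :
    M.unnormDensity θ * (M.acceptProb θ θ' * M.prop θ θ') =
      M.unnormDensity θ' * (M.acceptProb θ' θ * M.prop θ' θ) := by
  have ratio (x y : Θ) (hx : M.prior x * M.prop x y ≠ 0) :
      M.unnormDensity x * (M.acceptProb x y * M.prop x y) =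
        min (M.unnormDensity x * M.prop x y) (M.unnormDensity y * M.prop y x) := by
    have hp := (M.prod_lik_pos x).ne'
    have hw : (M.unnormDensity x * M.prop x y) * (M.wVar x y * ∏ a, M.wNode a x y) =
        M.unnormDensity y * M.prop y x := by
      have hprod : ∏ a, M.wNode a x y = (∏ a, M.lik a y) / ∏ a, M.lik a x :=
        Finset.prod_div_distrib _ _
      rw [wVar_eq, hprod, unnormDensity, unnormDensity]
      have h1 := left_ne_zero_of_mul hx
      have h2 := right_ne_zero_of_mul hx
      field_simp
    rw [← hw, acceptProb, if_neg hx, mul_left_comm, mul_comm, mul_min_of_nonneg _ _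
      (mul_nonneg (M.unnormDensity_nonneg x) (M.prop_nonneg x y)), mul_one]
  have zero (x y : Θ) (hx : M.prior x * M.prop x y = 0) :
      M.unnormDensity x * (M.acceptProb x y * M.prop x y) = 0 := by
    rw [unnormDensity]
    linear_combination (∏ a, M.lik a x) * M.acceptProb x y * hx
  by_cases h1 : M.prior θ * M.prop θ θ' = 0 <;> by_cases h2 : M.prior θ' * M.prop θ' θ = 0
  · rw [zero _ _ h1, zero _ _ h2]
  · rw [zero _ _ h1, M.acceptProb_eq_zero h2 h1]
    ring
  · rw [zero _ _ h2, M.acceptProb_eq_zero h1 h2]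
    ring
  · rw [ratio _ _ h1, ratio _ _ h2, min_comm]

instance isMarkovKernel_exactKernel : IsMarkovKernel M.exactKernel :=
  M.isMarkovKernel_mhKernel _ M.acceptProb_nonneg M.acceptProb_le_one

instance isMarkovKernel_approxKernel (m : ℕ) (ε : ℝ) : IsMarkovKernel (M.approxKernel m ε) :=
  M.isMarkovKernel_mhKernel _ (M.approxAcceptProb_nonneg m ε) (M.approxAcceptProb_le_one m ε)

theorem isReversible_exactKernel :
    M.exactKernel.IsReversible
      (M.base.withDensity fun θ => ENNReal.ofReal (M.unnormDensity θ)) := by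
  have := M.sigmaFinite_base
  have hh : Measurable fun θ => ENNReal.ofReal (M.unnormDensity θ) :=
    M.measurable_unnormDensity.ennreal_ofReal
  set g : Θ → Θ → ℝ≥0∞ := fun x y =>
    ENNReal.ofReal (M.unnormDensity x * (M.acceptProb x y * M.prop x y)) with hg
  have hgm : Measurable (Function.uncurry g) :=
    ((M.measurable_unnormDensity.comp measurable_fst).mul
      (M.measurable_acceptProb.mul M.measurable_prop)).ennreal_ofReal
  set r : Θ → ℝ≥0∞ := fun x => ENNReal.ofReal (M.unnormDensity x) *
    ∫⁻ y, ENNReal.ofReal ((1 - M.acceptProb x y) * M.prop x y) ∂M.base with hr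
  -- The flow from `A` to `B` is a moving part, symmetric by detailed balance and Tonelli, plus a
  -- holding part that sees only `A ∩ B`.
  have key (A B : Set Θ) (hA : MeasurableSet A) (hB : MeasurableSet B) :
      ∫⁻ x in A, M.exactKernel x B
          ∂(M.base.withDensity fun θ => ENNReal.ofReal (M.unnormDensity θ)) =
        ∫⁻ x in A, ∫⁻ y in B, g x y ∂M.base ∂M.base + ∫⁻ x in A ∩ B, r x ∂M.base := by
    have hgB : Measurable fun x => ∫⁻ y in B, g x y ∂M.base :=
      hgm.lintegral_prod_right' (ν := M.base.restrict B)
    rw [setLIntegral_withDensity_eq_setLIntegral_mul _ hh (M.exactKernel.measurable_coe hB) hA,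
      Set.inter_comm, ← setLIntegral_indicator hB,
      ← lintegral_add_left hgB]
    refine lintegral_congr fun x => ?_
    rw [Pi.mul_apply, exactKernel, M.mhKernel_apply' _ x hB, mul_add,
      ← lintegral_const_mul' _ _ ENNReal.ofReal_ne_top, ← mul_assoc]
    congr 1
    · refine lintegral_congr fun y => ?_
      rw [← ENNReal.ofReal_mul (M.unnormDensity_nonneg x)]
    · by_cases hx : x ∈ B <;> simp [hx, hr]
  intro A B hA hB
  rw [key A B hA hB, key B A hB hA, Set.inter_comm,
    lintegral_lintegral_swap hgm.aemeasurable]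
  congr 1
  refine lintegral_congr fun y => lintegral_congr fun x => ?_
  simp only [hg, M.unnormDensity_mul_acceptProb x y]

theorem invariant_target : M.exactKernel.Invariant M.target := by
  rw [Kernel.Invariant, target, Measure.comp_smul, M.isReversible_exactKernel.invariant]

/-! ### Comparison of the exact and the approximate chain -/

theorem abs_approx_sub_exact_le_one (m : ℕ) (ε : ℝ) (θ θ' : Θ) :
    |M.approxAcceptProb m ε θ θ' - M.acceptProb θ θ'| ≤ 1 := by
  rw [abs_le]
  constructor <;>
    linarith [M.approxAcceptProb_nonneg m ε θ θ', M.approxAcceptProb_le_one m ε θ θ',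
      M.acceptProb_nonneg θ θ', M.acceptProb_le_one θ θ']

/-- Bound on the total variation distance of one step of the two chains. -/
def stepDiff (m : ℕ) (ε : ℝ) : Θ → ℝ := M.acceptDiff (M.approxAcceptProb m ε) M.acceptProb

theorem norm_stepDiff_le (m : ℕ) (ε : ℝ) (θ : Θ) : ‖M.stepDiff m ε θ‖ ≤ 2 := by
  rw [stepDiff, Real.norm_eq_abs, abs_of_nonneg (M.acceptDiff_nonneg θ)]
  exact M.acceptDiff_le_two (M.measurable_approxAcceptProb m ε) M.measurable_acceptProb
    (M.abs_approx_sub_exact_le_one m ε) θ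

theorem abs_approxKernel_sub_le (m : ℕ) (ε : ℝ) (θ : Θ) {A : Set Θ} (hA : MeasurableSet A) :
    |(M.approxKernel m ε θ).real A - (M.exactKernel θ).real A| ≤ M.stepDiff m ε θ :=
  M.abs_mhKernel_sub_le _ _ (M.approxAcceptProb_nonneg m ε) (M.approxAcceptProb_le_one m ε)
    M.acceptProb_nonneg M.acceptProb_le_one θ hA

theorem tendsto_stepDiff {m : ℕ} (hN : 0 < N) (hm : 0 < m) (θ : Θ) :
    Tendsto (fun ε => M.stepDiff m ε θ) (𝓝[>] 0) (𝓝 0) := by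
  have h : Tendsto (fun ε => ∫ θ', |M.approxAcceptProb m ε θ θ' - M.acceptProb θ θ'| *
      M.prop θ θ' ∂M.base) (𝓝[>] 0) (𝓝 (∫ _, (0 : ℝ) ∂M.base)) := by
    refine tendsto_integral_filter_of_dominated_convergence (M.prop θ)
      (Eventually.of_forall fun ε => (M.integrable_abs_sub_mul_prop
        (M.measurable_approxAcceptProb m ε) M.measurable_acceptProb
        (M.abs_approx_sub_exact_le_one m ε) θ).aestronglyMeasurable)
      (Eventually.of_forall fun ε => ae_of_all _ fun θ' => ?_) (M.integrable_prop θ)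
      (ae_of_all _ fun θ' => ?_)
    · rw [Real.norm_eq_abs, abs_mul, abs_abs, abs_of_nonneg (M.prop_nonneg θ θ')]
      exact mul_le_of_le_one_left (M.prop_nonneg _ _) (M.abs_approx_sub_exact_le_one m ε θ θ')
    · have := ((M.tendsto_approxAcceptProb hN hm θ θ').sub_const (M.acceptProb θ θ')).abs.mul_const
        (M.prop θ θ')
      simpa using this
  simpa [stepDiff, acceptDiff] using h.const_mul 2

theorem integrable_stepDiff (m : ℕ) (ε : ℝ) (π : Measure Θ) [IsProbabilityMeasure π] :
    Integrable (M.stepDiff m ε) π :=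
  Integrable.of_bound (M.measurable_acceptDiff (M.measurable_approxAcceptProb m ε)
    M.measurable_acceptProb).aestronglyMeasurable 2 (ae_of_all _ (M.norm_stepDiff_le m ε))

theorem tendsto_integral_stepDiff {m : ℕ} (hN : 0 < N) (hm : 0 < m) (π : Measure Θ)
    [IsProbabilityMeasure π] :
    Tendsto (fun ε => ∫ θ, M.stepDiff m ε θ ∂π) (𝓝[>] 0) (𝓝 0) := by
  have h : Tendsto (fun ε => ∫ θ, M.stepDiff m ε θ ∂π) (𝓝[>] 0) (𝓝 (∫ _, (0 : ℝ) ∂π)) := by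
    exact tendsto_integral_filter_of_dominated_convergence (fun _ => 2)
      (Eventually.of_forall fun ε => (M.integrable_stepDiff m ε π).aestronglyMeasurable)
      (Eventually.of_forall fun ε => ae_of_all _ (M.norm_stepDiff_le m ε))
      (integrable_const _) (ae_of_all _ fun θ => M.tendsto_stepDiff hN hm θ)
  simpa using h

theorem tvDist_bind_approxKernel_le (m : ℕ) (ε : ℝ) (π : Measure Θ) [IsProbabilityMeasure π] :
    tvDist (π.bind (M.approxKernel m ε)) (π.bind M.exactKernel) ≤ ∫ θ, M.stepDiff m ε θ ∂π := by
  have int (κ : Kernel Θ Θ) [IsMarkovKernel κ] {A : Set Θ} (hA : MeasurableSet A) :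
      Integrable (fun θ => (κ θ).real A) π :=
    Integrable.of_bound (measurable_kernel_real κ hA).aestronglyMeasurable 1
      (ae_of_all _ fun t => by
        rw [Real.norm_eq_abs, abs_of_nonneg measureReal_nonneg]; exact measureReal_le_one)
  refine tvDist_le fun A hA => ?_
  rw [measureReal_bind π _ hA, measureReal_bind π _ hA, ← integral_sub (int _ hA) (int _ hA)]
  exact abs_integral_le_integral_abs.trans (integral_mono ((int _ hA).sub (int _ hA)).abs
    (M.integrable_stepDiff m ε π) fun θ => M.abs_approxKernel_sub_le m ε θ hA)

theorem tendsto_tvDist_approxKernel {m : ℕ} (hN : 0 < N) (hm : 0 < m) (θ : Θ) :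
    Tendsto (fun ε => tvDist (M.approxKernel m ε θ) (M.exactKernel θ)) (𝓝[>] 0) (𝓝 0) :=
  squeeze_zero (fun _ => tvDist_nonneg _ _)
    (fun ε => tvDist_le fun _ hA => M.abs_approxKernel_sub_le m ε θ hA)
    (M.tendsto_stepDiff hN hm θ)

/-- If the exact chain is minorised, all approximate chains are minorised with the same
constant. -/
theorem exists_approxKernel_minorised {m : ℕ} (hN : 0 < N) (hm : 0 < m)
    (h : Doeblin M.exactKernel) :
    ∃ n, 1 ≤ n ∧ ∃ c : ℝ, 0 < c ∧ c < 1 ∧ ∃ ν : Measure Θ, IsProbabilityMeasure ν ∧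
      ∀ ε θ A, MeasurableSet A → ENNReal.ofReal c * ν A ≤ (M.approxKernel m ε ^ n) θ A := by
  obtain ⟨n, hn, c, hc, ν, hν, hmin⟩ := h
  set f : ℝ := (N.factorial : ℝ)⁻¹ with hf
  have hf0 : 0 < f := inv_pos.2 (by exact_mod_cast N.factorial_pos)
  -- The cap `1/2` makes the constant finite and strictly below 1, as the contraction lemmas
  -- require.
  have hd : 0 < min (ENNReal.ofReal f ^ n * c) (2 : ℝ≥0∞)⁻¹ :=
    lt_min (ENNReal.mul_pos (pow_ne_zero _ (by simpa using hf0)) hc.ne') (by simp)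
  have hd' : min (ENNReal.ofReal f ^ n * c) (2 : ℝ≥0∞)⁻¹ ≠ ∞ :=
    ne_top_of_le_ne_top (by simp) (min_le_right _ _)
  refine ⟨n, hn, (min (ENNReal.ofReal f ^ n * c) (2 : ℝ≥0∞)⁻¹).toReal,
    ENNReal.toReal_pos hd.ne' hd', ?_, ν, hν, fun ε θ A hA => ?_⟩
  · refine (ENNReal.toReal_mono (by simp) (min_le_right _ _)).trans_lt ?_
    norm_num
  · rw [ENNReal.ofReal_toReal hd']
    calc min (ENNReal.ofReal f ^ n * c) (2 : ℝ≥0∞)⁻¹ * ν A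
        ≤ ENNReal.ofReal f ^ n * c * ν A := by gcongr; exact min_le_left _ _
      _ ≤ ENNReal.ofReal f ^ n * (M.exactKernel ^ n) θ A := by
          rw [mul_assoc]
          gcongr
          exact hmin θ A hA
      _ ≤ (M.approxKernel m ε ^ n) θ A :=
          pow_mul_kernel_pow_le ENNReal.ofReal_ne_top (fun θ A hA => M.mul_mhKernel_le _ _ hf0.le
            (M.inv_factorial_mul_acceptProb_le hN hm ε)
            (M.inv_factorial_mul_one_sub_acceptProb_le hN hm ε) θ hA) n θ hA

/-- The only use of compactness or finiteness in the ergodic part: a bounded likelihood makes the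
target normalisable. -/
theorem exists_prod_lik_le [TopologicalSpace Θ]
    (hΘ : (CompactSpace Θ ∧ ∀ a, Continuous (M.lik a)) ∨ Finite Θ) :
    ∃ b, ∀ θ, ∏ a, M.lik a θ ≤ b := by
  have hbdd : BddAbove (Set.range fun θ => ∏ a, M.lik a θ) := by
    rcases hΘ with ⟨_, hc⟩ | _
    · exact (isCompact_range (continuous_finsetProd _ fun a _ => hc a)).bddAbove
    · exact (Set.finite_range _).bddAbove
  obtain ⟨b, hb⟩ := hbdd
  exact ⟨b, fun θ => hb ⟨θ, rfl⟩⟩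

end Model

end SubsampledMH

end

/-! ### Ergodicity and convergence of the approximate chain. -/

theorem corollary1 {Θ ι : Type*} [TopologicalSpace Θ] [MeasurableSpace Θ] [BorelSpace Θ]
    [Fintype ι] {N : ℕ} (hN : 0 < N) (M : SubsampledMH.Model Θ ι N) (m : ℕ) (hm : 0 < m)
    (hΘ : (CompactSpace Θ ∧ ∀ a, Continuous (M.lik a)) ∨ Finite Θ)
    (hreg : SubsampledMH.Doeblin M.exactKernel) :
    (∃ πε : ℝ → Measure Θ,
      (∃ ε₀ > 0, ∀ ε, 0 < ε → ε < ε₀ →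
        SubsampledMH.UniformlyErgodic (M.approxKernel m ε) (πε ε) ∧
        ∀ ν : Measure Θ, IsProbabilityMeasure ν → (M.approxKernel m ε).Invariant ν → ν = πε ε) ∧
      Tendsto (fun ε => SubsampledMH.tvDist (πε ε) M.target) (𝓝[>] 0) (𝓝 0)) ∧
    (∀ θ, Tendsto (fun ε => SubsampledMH.tvDist (M.approxKernel m ε θ) (M.exactKernel θ)) (𝓝[>] 0) (𝓝 0)) ∧
    (Finite Θ → ∃ δ : ℝ → ℝ, Tendsto δ (𝓝[>] 0) (𝓝 0) ∧
      ∀ ε, 0 < ε → ∀ θ, SubsampledMH.tvDist (M.approxKernel m ε θ) (M.exactKernel θ) ≤ δ ε) := by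
  obtain ⟨b, hb⟩ := M.exists_prod_lik_le hΘ
  have htarget := M.isProbabilityMeasure_target hb
  obtain ⟨n, hn, c, hc0, hc1, ν, hν, hmin⟩ := M.exists_approxKernel_minorised hN hm hreg
  have herg (ε : ℝ) := SubsampledMH.exists_uniformlyErgodic hn hc0 hc1 (hmin ε)
  choose πε hπ huniq using herg
  -- The minorisation holds for every `ε`, so the choice `ε₀ = 1` is arbitrary.
  refine ⟨⟨πε, ⟨1, one_pos, fun ε _ _ => ⟨hπ ε, huniq ε⟩⟩, ?_⟩,
    M.tendsto_tvDist_approxKernel hN hm, fun _ => ?_⟩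
  · refine squeeze_zero (fun _ => SubsampledMH.tvDist_nonneg _ _) (fun ε => ?_)
      (by simpa using (M.tendsto_integral_stepDiff hN hm M.target).const_mul ((n : ℝ) / c))
    have := (hπ ε).1
    refine (SubsampledMH.tvDist_invariant_le hc0 hc1 (hmin ε) (hπ ε).2.1).trans ?_
    gcongr
    have h := M.tvDist_bind_approxKernel_le m ε M.target
    rwa [M.invariant_target] at h
  · have := Fintype.ofFinite Θ
    -- On a finite space the sum over `θ` dominates each distance and inherits the pointwise limit.
    refine ⟨fun ε => ∑ θ, SubsampledMH.tvDist (M.approxKernel m ε θ) (M.exactKernel θ), ?_,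
      fun ε _ θ => Finset.single_le_sum
        (f := fun θ => SubsampledMH.tvDist (M.approxKernel m ε θ) (M.exactKernel θ))
        (fun _ _ => SubsampledMH.tvDist_nonneg _ _) (Finset.mem_univ θ)⟩
    simpa using tendsto_finsetSum Finset.univ
      fun θ _ => M.tendsto_tvDist_approxKernel hN hm θ
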